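/- Let $N\ge 1$, let $\{0,1\}^N$ be the set of binary numbers $m$ with exactly $N$ digits (the $k$-th digit, $1\le k\le N$, is the coefficient of $2^{k-1}$), and let $\mathbb{C}\{0,1\}^N$ be the free complex vector space on it. For a formal sum $s$ of integers, such as $s=+2^a$ or $s=\pm2^a\pm2^b$, let $\overline{s}$ be the linear operator on $\mathbb{C}\{0,1\}^N$ with $\overline{s}(m)=m+s$ if $m+s\neq m$ and the successive additions and subtractions can be performed on $N$-digit binary numbers without any carrying or borrowing, and $\overline{s}(m)=0$ otherwise. For $1\le k\le N$ let $p_k$ be the parity operator, $p_k(m)=-m$ if the $k$-th digit of $m$ is $1$ and $p_k(m)=m$ if it is $0$. For $0\le M\le N$ let $\mathfrak{g}_M\subset\operatorname{End}(\mathbb{C}\{0,1\}^N)$ be the complex Lie algebra of operators generated by those of the operators $B^{\pm1}=\overline{\pm1}$ and $B^{\pm k}=\overline{\pm2^{k-1}\mp2^{k-2}}$ ($2\le k\le N$) whose index satisfies $1\le k\le M$; thus $\mathfrak{g}_{N-1}\subset\mathfrak{g}_N$. Put $C=\overline{+2^{N-1}}+\overline{-2^{N-1}}$, and let $\mathfrak{d}_N$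 be the Lie algebra generated by $\mathfrak{g}_{N-1}$ together with the element $p_{N-1}p_{N-2}\cdots p_1\circ C$. Empty products of parity operators are the identity. Then: 1. $\mathfrak{d}_N$ is a Lie subalgebra of $\mathfrak{g}_N$. 2. There is an isomorphism of Lie algebras $\mathfrak{so}(2N,\mathbb{C})\cong\mathfrak{d}_N$ under which $\mathbb{C}\{0,1\}^N$ becomes the spin representation of $\mathfrak{so}(2N,\mathbb{C})$, that is, the restriction of a simple module of the Clifford algebra of $(\mathbb{C}^{2N},\,x_1^2+\dots+x_{2N}^2)$ along the standard embedding $X\mapsto\frac14\sum_{i,j}X_{ij}e_ie_j$. This representation is decomposable: $\mathbb{C}\{0,1\}^N$ is a direct sum of two nonzero $\mathfrak{d}_N$-invariant subspaces. 3. The Lie algebra $\mathfrak{g}_{N-1}$ has as a basis the elements $$p_i\quad(1\le i\le N-1),\qquad p_1p_2\cdots p_{k-1}\circ\overline{\pm2^{k-1}}\quad(1\le k\le N-1),$$ $$p_{l+1}p_{l+2}\cdots p_{k-1}\circ\overline{\pm2^{k-1}\pm2^{l-1}}\quad(1\le l<k\le N-1,\ \text{all four choices of signs}),$$ and $\mathfrak{d}_N$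 has as a basis these elements together with the generator $p_{N-1}p_{N-2}\cdots p_1\circ C$ and the elements $$p_{N-1}p_{N-2}\cdots p_j\circ\overline{\pm2^{j-2}}\circ C\qquad(2\le j\le N,\ \text{both signs}).$$ -/

import Mathlib

attribute [local instance 100] LieRing.ofAssociativeRing

namespace SpinArith

noncomputable section

/-- Binary numbers with exactly `N` digits; `m i` is the coefficient of `2 ^ i` in `m`. -/
abbrev Bits (N : ℕ) : Type := Fin N → Bool

/-- The free complex vector space on the `N`-digit binary numbers. -/
abbrev Spinor (N : ℕ) : Type := Bits N →₀ ℂ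

/-- Adding the integer `k` to `m` digit by digit, defined only if no carrying (or borrowing) is
needed: `|k|` must have at most `N` digits, and at each digit `1` of `|k|` the digit of `m` must be
`0` if `k` is positive and `1` if `k` is negative. These are the digits that get flipped. -/
def addNoCarry {N : ℕ} (k : ℤ) (m : Bits N) : Option (Bits N) :=
  if k.natAbs < 2 ^ N ∧ ∀ i : Fin N, k.natAbs.testBit i = true → m i = decide (k < 0) then
    some (fun i => xor (m i) (k.natAbs.testBit i))
  else none

/-- The arithmetic function of a formal sum of integers (a list of summands): perform all the
additions without carrying, and leave the argument fixed if one of them would need carrying. -/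
def arithFun {N : ℕ} (s : List ℤ) (m : Bits N) : Bits N :=
  (s.foldlM (fun x k => addNoCarry k x) m).getD m

/-- The arithmetic operator of a formal sum: the linear operator that sends a basis vector `m` to
`0` if the arithmetic function `f` fixes `m`, and to `f m` otherwise. -/
def arithOp (N : ℕ) (s : List ℤ) : Module.End ℂ (Spinor N) :=
  Finsupp.linearCombination ℂ fun m : Bits N =>
    if arithFun s m = m then 0 else Finsupp.single (arithFun s m) (1 : ℂ)

/-- The coefficient of `2 ^ i` in `m`, which is zero beyond the last digit. -/
def digit {N : ℕ} (m : Bits N) (i : ℕ) : Bool :=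
  if h : i < N then m ⟨i, h⟩ else false

/-- The parity operator `p_k` for `1 ≤ k ≤ N`: it multiplies `m` by `-1` if the `k`-th digit of `m`,
that is the coefficient of `2 ^ (k - 1)`, is `1`. -/
def parityOp (N k : ℕ) : Module.End ℂ (Spinor N) :=
  Finsupp.linearCombination ℂ fun m : Bits N =>
    Finsupp.single m (if digit m (k - 1) = true then (-1 : ℂ) else 1)

/-- The composition `p_a ∘ p_(a+1) ∘ ⋯ ∘ p_b`; it is the identity if `b < a`. -/
def parityProd (N a b : ℕ) : Module.End ℂ (Spinor N) :=
  ((List.Ico a (b + 1)).map (parityOp N)).prod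

/-- The bit shift operators `B^{±k}` for `k ≥ 1`, the sign being `ε`: `B^{±1}` is the operator of
`±1`, and for `k ≥ 2` the operator `B^{±k}` is that of `±2^(k-1) ∓ 2^(k-2)`. -/
def shiftOp (N : ℕ) (ε : ℤˣ) (k : ℕ) : Module.End ℂ (Spinor N) :=
  if k = 1 then arithOp N [(ε : ℤ)]
  else arithOp N [(ε : ℤ) * 2 ^ (k - 1), -(ε : ℤ) * 2 ^ (k - 2)]

/-- The Lie algebra `g_M` for `M ≤ N`, as operators on `N`-digit numbers: it is generated by
`B^{±1}, …, B^{±M}`. -/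
def oddSpin (N M : ℕ) : LieSubalgebra ℂ (Module.End ℂ (Spinor N)) :=
  LieSubalgebra.lieSpan ℂ (Module.End ℂ (Spinor N))
    {A | ∃ k : ℕ, ∃ ε : ℤˣ, 1 ≤ k ∧ k ≤ M ∧ A = shiftOp N ε k}

/-- The linear combination `+2^(N-1)` plus `-2^(N-1)` of arithmetic operators. -/
def flipTop (N : ℕ) : Module.End ℂ (Spinor N) :=
  arithOp N [2 ^ (N - 1)] + arithOp N [-2 ^ (N - 1)]

/-- The additional generator `p_(N-1) ⋯ p_1 ∘ (+2^(N-1) plus -2^(N-1))`. -/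
def evenGen (N : ℕ) : Module.End ℂ (Spinor N) :=
  parityProd N 1 (N - 1) * flipTop N

/-- The Lie algebra `d_N`, generated by `g_(N-1)` and the additional generator. -/
def evenSpin (N : ℕ) : LieSubalgebra ℂ (Module.End ℂ (Spinor N)) :=
  LieSubalgebra.lieSpan ℂ (Module.End ℂ (Spinor N))
    ((oddSpin N (N - 1) : Set (Module.End ℂ (Spinor N))) ∪ {evenGen N})

/-- Labels for the explicit basis of `g_M`. -/
inductive OddIndex (M : ℕ) : Type
  | parity (i : Fin M)
  | single (ε : ℤˣ) (k : Fin M)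
  | pair (ε δ : ℤˣ) (k l : Fin M) (h : l < k)

/-- The elements of the explicit basis of `g_M`. -/
def oddElement (N : ℕ) {M : ℕ} : OddIndex M → Module.End ℂ (Spinor N)
  | .parity i => parityOp N (i + 1)
  | .single ε k => parityProd N 1 k * arithOp N [(ε : ℤ) * 2 ^ (k : ℕ)]
  | .pair ε δ k l _ =>
      parityProd N (l + 2) k * arithOp N [(ε : ℤ) * 2 ^ (k : ℕ), (δ : ℤ) * 2 ^ (l : ℕ)]

/-- Labels for the explicit basis of `d_N`. -/
inductive EvenIndex (N : ℕ) : Type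
  | odd (a : OddIndex (N - 1))
  | gen
  | mixed (ε : ℤˣ) (l : Fin (N - 1))

/-- The elements of the explicit basis of `d_N`: those of `g_(N-1)`, the additional generator, and
`p_(N-1) ⋯ p_j ∘ (±2^(j-2)) ∘ (+2^(N-1) plus -2^(N-1))` for `2 ≤ j ≤ N`, where `j = l + 2`. -/
def evenElement (N : ℕ) : EvenIndex N → Module.End ℂ (Spinor N)
  | .odd a => oddElement N a
  | .gen => evenGen N
  | .mixed ε l =>
      parityProd N (l + 2) (N - 1) * arithOp N [(ε : ℤ) * 2 ^ (l : ℕ)] * flipTop N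

/-- The quadratic form `x_1 ^ 2 + ⋯ + x_n ^ 2` on `ℂ ^ n`. -/
def sumSq (n : ℕ) : QuadraticForm ℂ (Fin n → ℂ) :=
  QuadraticMap.weightedSumSquares ℂ (fun _ : Fin n => (1 : ℂ))

/-- The embedding of `so(n, ℂ)` into the Clifford algebra (with `v * v = sumSq n v`), given by
`X ↦ (1/4) ∑ X_ij e_i e_j`; it is characterised by `ρ(X) v - v ρ(X) = X v` for vectors `v`, and it
sends `E_ij - E_ji` to `(1/2) e_i e_j` for `i ≠ j`. -/
def soToClifford (n : ℕ) (X : LieAlgebra.Orthogonal.so (Fin n) ℂ) : CliffordAlgebra (sumSq n) :=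
  (1 / 4 : ℂ) • ∑ i : Fin n, ∑ j : Fin n, (X : Matrix (Fin n) (Fin n) ℂ) i j •
    (CliffordAlgebra.ι (sumSq n) (Pi.single i 1) * CliffordAlgebra.ι (sumSq n) (Pi.single j 1))

/-- A representation of `so(2N, ℂ)` on `V` is the spin representation if it is the restriction,
along the embedding of `so(2N, ℂ)` into the Clifford algebra, of a simple module structure of the
Clifford algebra on `V`. (The Clifford algebra of an even-dimensional space has exactly one simple
module up to isomorphism, so this determines the representation up to equivalence.) -/
def IsSpinRepresentation {N : ℕ} {V : Type*} [AddCommGroup V] [Module ℂ V]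
    (ρ : LieAlgebra.Orthogonal.so (Fin (2 * N)) ℂ →ₗ⁅ℂ⁆ Module.End ℂ V) : Prop :=
  Nontrivial V ∧ ∃ c : CliffordAlgebra (sumSq (2 * N)) →ₐ[ℂ] Module.End ℂ V,
    (∀ W : Submodule ℂ V, (∀ a, ∀ w ∈ W, c a w ∈ W) → W = ⊥ ∨ W = ⊤) ∧
    ∀ X, ρ X = c (soToClifford (2 * N) X)

end

end SpinArith

namespace SpinArith

noncomputable section

/-! The digits form `N` commuting two-level systems, with ladder operators `a ε k` (`k` counted from
zero) and parities `Z (k + 1)`. The Jordan-Wigner operators `ferm ε k = Z 1 ⋯ Z k * a ε k` satisfy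
the canonical anticommutation relations (`ferm_anticommutator`). A bit shift of index at least two
is, up to sign, a product of two neighbouring fermionic operators, and brackets with such products
carry `ferm ε k` to `ferm ε (k + 1)`. Hence `g_M` is generated by the `ferm ε k` with `k < M`, and
`d_N` by those with `k < N - 1` together with the sum of the two last ones.

Operators with scalar anticommutators form a Lie triple system, so the Lie algebra they generate is
the span of the operators and their brackets (`lieSpan_toSubmodule_of_triple`). Computing the
brackets shows that the listed elements span.

The `2N` combinations `gamma` of the fermionic operators are anticommuting square roots of one, and
`d_N` is generated by all of them but one, `γ_o`. Replacing the other `γ_i` by `√-1 γ_i γ_o` gives a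
Clifford family whose products of two distinct members are, up to scalars, the `γ_i` and the `γ_i
γ_j` with `i, j ≠ o`. So the embedding of `so(2N)` by quadratic elements has image exactly `d_N`
(`cliffordHom_range_eq_evenSpin`). It is injective, and `dim so(2N)` is at least `N (2N - 1)`, the
number of listed elements; these are therefore independent, and so is the subfamily for `g_(N-1)`.

The Clifford module is simple because the family generates all parities and ladder operators:
parities isolate a basis vector and flips move it to every other. It decomposes under `d_N` because
flipping the last digit is an involution, different from `± 1`, that commutes with `d_N`. -/

/-! ### Ladder and parity operators on binary numbers -/

theorem spinor_hom_ext {N : ℕ} {A B : Module.End ℂ (Spinor N)}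
    (h : ∀ m : Bits N, A (Finsupp.single m 1) = B (Finsupp.single m 1)) : A = B := by
  refine Finsupp.lhom_ext' fun m => LinearMap.ext_ring ?_
  simpa using h m

/-- Flip the digit `k`. -/
def flipBit {N : ℕ} (k : Fin N) (m : Bits N) : Bits N := Function.update m k (!m k)

/-- The operator of `± 2 ^ k`. -/
def ladder (N : ℕ) (ε : ℤˣ) (k : ℕ) : Module.End ℂ (Spinor N) :=
  arithOp N [(ε : ℤ) * 2 ^ k]

theorem flipBit_ne {N : ℕ} (k : Fin N) (m : Bits N) : flipBit k m ≠ m := by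
  intro h
  have := congrFun h k
  simp [flipBit] at this

theorem flipBit_flipBit {N : ℕ} (k : Fin N) (m : Bits N) : flipBit k (flipBit k m) = m := by
  simp [flipBit]

theorem flipBit_self {N : ℕ} (k : Fin N) (m : Bits N) : flipBit k m k = !m k := by
  simp [flipBit]

theorem flipBit_of_ne {N : ℕ} {k l : Fin N} (h : l ≠ k) (m : Bits N) : flipBit k m l = m l := by
  simp [flipBit, h]

theorem flipBit_comm {N : ℕ} (k l : Fin N) (m : Bits N) :
    flipBit k (flipBit l m) = flipBit l (flipBit k m) := by
  rcases eq_or_ne k l with rfl | h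
  · rfl
  · simp only [flipBit, Function.update_of_ne h, Function.update_of_ne h.symm]
    exact Function.update_comm h.symm _ _ _

theorem addNoCarry_two_pow {N : ℕ} (ε : ℤˣ) (k : Fin N) (m : Bits N) :
    addNoCarry ((ε : ℤ) * 2 ^ (k : ℕ)) m =
      if m k = decide (ε = -1) then some (flipBit k m) else none := by
  have habs : ((ε : ℤ) * 2 ^ (k : ℕ)).natAbs = 2 ^ (k : ℕ) := by
    rw [Int.natAbs_mul, Int.natAbs_pow, Int.isUnit_iff_natAbs_eq.1 ε.isUnit, one_mul]
    rfl
  have hneg : decide ((ε : ℤ) * 2 ^ (k : ℕ) < 0) = decide (ε = -1) := by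
    rcases Int.units_eq_one_or ε with rfl | rfl
    · simp
    · simp
  have hflip : (fun i : Fin N => xor (m i) ((2 ^ (k : ℕ)).testBit i)) = flipBit k m := by
    ext i
    rcases eq_or_ne i k with rfl | h
    · simp [flipBit_self]
    · have : (k : ℕ) ≠ i := fun e => h (Fin.ext e.symm)
      simp [flipBit_of_ne h, this]
  unfold addNoCarry
  rw [habs, hneg, hflip]
  have hlt : 2 ^ (k : ℕ) < 2 ^ N := Nat.pow_lt_pow_right (by norm_num) k.2
  have hiff : (∀ i : Fin N, (2 ^ (k : ℕ)).testBit i = true → m i = decide (ε = -1)) ↔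
      m k = decide (ε = -1) := by
    constructor
    · intro h
      exact h k (by simp)
    · intro h i hi
      rw [Nat.testBit_two_pow] at hi
      have : k = i := Fin.ext (by simpa using hi)
      rw [← this, h]
  simp only [hlt, hiff, true_and]

theorem ladder_single {N : ℕ} (ε : ℤˣ) (k : Fin N) (m : Bits N) :
    ladder N ε k (Finsupp.single m 1) =
      if m k = decide (ε = -1) then Finsupp.single (flipBit k m) 1 else 0 := by
  by_cases h : m k = decide (ε = -1) <;>
    simp [ladder, arithOp, arithFun, addNoCarry_two_pow, h, flipBit_ne]

/-- The first summand of the formal sum acts first, so it becomes the right factor. -/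
theorem arithOp_pair {N : ℕ} (ε δ : ℤˣ) {k l : ℕ} (hk : k < N) (hl : l < N) (hkl : k ≠ l) :
    arithOp N [(ε : ℤ) * 2 ^ k, (δ : ℤ) * 2 ^ l] = ladder N δ l * ladder N ε k := by
  lift k to Fin N using hk
  lift l to Fin N using hl
  have hkl' : l ≠ k := fun e => hkl (by rw [e])
  refine spinor_hom_ext fun m => ?_
  -- `arithOp` kills fixed points, so a successful double addition has to be seen to move `m`.
  have hne : flipBit l (flipBit k m) ≠ m := by
    intro e
    have := congrFun e l
    simp [flipBit_self, flipBit_of_ne hkl'] at this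
  rw [Module.End.mul_apply, ladder_single]
  by_cases h : m k = decide (ε = -1)
  · by_cases h' : m l = decide (δ = -1) <;>
      simp [ladder_single, arithOp, arithFun, addNoCarry_two_pow, h, h', hne, flipBit_of_ne hkl']
  · simp [arithOp, arithFun, addNoCarry_two_pow, h]

theorem parityOp_single {N : ℕ} (k : Fin N) (m : Bits N) :
    parityOp N (k + 1) (Finsupp.single m 1) =
      (if m k = true then (-1 : ℂ) else 1) • Finsupp.single m 1 := by
  by_cases h : m k = true <;> simp [parityOp, digit, h]

theorem parityOp_commute (N i j : ℕ) : Commute (parityOp N i) (parityOp N j) := by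
  refine spinor_hom_ext fun m => ?_
  by_cases h : digit m (i - 1) = true <;> by_cases h' : digit m (j - 1) = true <;>
    simp [parityOp, h, h']

theorem parityOp_mul_self (N i : ℕ) : parityOp N i * parityOp N i = 1 := by
  refine spinor_hom_ext fun m => ?_
  by_cases h : digit m (i - 1) = true <;> simp [parityOp, h]

theorem ladder_mul_self {N : ℕ} (ε : ℤˣ) {k : ℕ} (hk : k < N) :
    ladder N ε k * ladder N ε k = 0 := by
  lift k to Fin N using hk
  refine spinor_hom_ext fun m => ?_
  by_cases h : m k = decide (ε = -1) <;>
    simp [ladder_single, h, flipBit_self]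

theorem ladder_mul_neg_add {N : ℕ} (ε : ℤˣ) {k : ℕ} (hk : k < N) :
    ladder N ε k * ladder N (-ε) k + ladder N (-ε) k * ladder N ε k = 1 := by
  lift k to Fin N using hk
  refine spinor_hom_ext fun m => ?_
  rcases Int.units_eq_one_or ε with rfl | rfl <;> by_cases h : m k = true <;>
    simp [ladder_single, h, flipBit_self, flipBit_flipBit]

theorem ladder_mul_neg_sub {N : ℕ} (ε : ℤˣ) {k : ℕ} (hk : k < N) :
    ladder N ε k * ladder N (-ε) k - ladder N (-ε) k * ladder N ε k =
      (-((ε : ℤ) : ℂ)) • parityOp N (k + 1) := by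
  lift k to Fin N using hk
  refine spinor_hom_ext fun m => ?_
  rcases Int.units_eq_one_or ε with rfl | rfl <;> by_cases h : m k = true <;>
    simp [ladder_single, parityOp_single, h, flipBit_self, flipBit_flipBit]

theorem ladder_commute {N : ℕ} (ε δ : ℤˣ) {k l : ℕ} (hk : k < N) (hl : l < N) (hkl : k ≠ l) :
    Commute (ladder N ε k) (ladder N δ l) := by
  lift k to Fin N using hk
  lift l to Fin N using hl
  have hkl' : l ≠ k := fun e => hkl (by rw [e])
  refine spinor_hom_ext fun m => ?_
  by_cases h : m k = decide (ε = -1) <;> by_cases h' : m l = decide (δ = -1) <;>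
    simp [ladder_single, h, h', flipBit_of_ne hkl', flipBit_of_ne hkl'.symm, flipBit_comm k l]

theorem parityOp_commute_ladder {N : ℕ} (ε : ℤˣ) {k l : ℕ} (hk : k < N) (hl : l < N)
    (hkl : k ≠ l) : Commute (parityOp N (k + 1)) (ladder N ε l) := by
  lift k to Fin N using hk
  lift l to Fin N using hl
  have hkl' : k ≠ l := fun e => hkl (by rw [e])
  refine spinor_hom_ext fun m => ?_
  by_cases h : m k = true <;> by_cases h' : m l = decide (ε = -1) <;>
    simp [ladder_single, parityOp_single, h, h', flipBit_of_ne hkl']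

theorem parityOp_mul_ladder {N : ℕ} (ε : ℤˣ) {k : ℕ} (hk : k < N) :
    parityOp N (k + 1) * ladder N ε k = (-((ε : ℤ) : ℂ)) • ladder N ε k := by
  lift k to Fin N using hk
  refine spinor_hom_ext fun m => ?_
  rcases Int.units_eq_one_or ε with rfl | rfl <;> by_cases h : m k = true <;>
    simp [ladder_single, parityOp_single, h, flipBit_self]

theorem ladder_mul_parityOp {N : ℕ} (ε : ℤˣ) {k : ℕ} (hk : k < N) :
    ladder N ε k * parityOp N (k + 1) = (((ε : ℤ) : ℂ)) • ladder N ε k := by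
  lift k to Fin N using hk
  refine spinor_hom_ext fun m => ?_
  rcases Int.units_eq_one_or ε with rfl | rfl <;> by_cases h : m k = true <;>
    simp [ladder_single, parityOp_single, h]

/-! ### Lie algebras generated by Lie triple systems -/

section TripleSystem

variable {A ι : Type*} [LieRing A] [LieAlgebra ℂ A]

/-- A Lie algebra generated by a Lie triple system `x` is spanned by `x` and its brackets. -/
theorem lieSpan_toSubmodule_of_triple (x : ι → A)
    (h : ∀ i j k, ⁅⁅x i, x j⁆, x k⁆ ∈ Submodule.span ℂ (Set.range x)) :
    (LieSubalgebra.lieSpan ℂ A (Set.range x)).toSubmodule =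
      Submodule.span ℂ (Set.range x ∪ Set.range fun p : ι × ι => ⁅x p.1, x p.2⁆) := by
  set R := Submodule.span ℂ (Set.range x) with hR
  set B := Submodule.span ℂ (Set.range fun p : ι × ι => ⁅x p.1, x p.2⁆) with hB
  have hRR : ∀ u ∈ R, ∀ v ∈ R, ⁅u, v⁆ ∈ B := by
    intro u hu v hv
    induction hu using Submodule.span_induction with
    | zero => simp
    | add a b _ _ ha hb => rw [add_lie]; exact add_mem ha hb
    | smul c a _ ha => rw [smul_lie]; exact B.smul_mem c ha
    | mem a ha =>
      obtain ⟨i, rfl⟩ := ha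
      induction hv using Submodule.span_induction with
      | zero => simp
      | add a b _ _ ha hb => rw [lie_add]; exact add_mem ha hb
      | smul c a _ ha => rw [lie_smul]; exact B.smul_mem c ha
      | mem a ha =>
        obtain ⟨j, rfl⟩ := ha
        exact Submodule.subset_span ⟨(i, j), rfl⟩
  have hBR : ∀ u ∈ B, ∀ v ∈ R, ⁅u, v⁆ ∈ R := by
    intro u hu v hv
    induction hu using Submodule.span_induction with
    | zero => simp
    | add a b _ _ ha hb => rw [add_lie]; exact add_mem ha hb
    | smul c a _ ha => rw [smul_lie]; exact R.smul_mem c ha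
    | mem a ha =>
      obtain ⟨p, rfl⟩ := ha
      induction hv using Submodule.span_induction with
      | zero => simp
      | add a b _ _ ha hb => rw [lie_add]; exact add_mem ha hb
      | smul c a _ ha => rw [lie_smul]; exact R.smul_mem c ha
      | mem a ha =>
        obtain ⟨j, rfl⟩ := ha
        exact h _ _ _
  have hBB : ∀ u ∈ B, ∀ v ∈ B, ⁅u, v⁆ ∈ B := by
    intro u hu v hv
    induction hv using Submodule.span_induction with
    | zero => simp
    | add a b _ _ ha hb => rw [lie_add]; exact add_mem ha hb
    | smul c a _ ha => rw [lie_smul]; exact B.smul_mem c ha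
    | mem a ha =>
      obtain ⟨p, rfl⟩ := ha
      have hx : ∀ i, x i ∈ R := fun i => Submodule.subset_span ⟨i, rfl⟩
      -- The Jacobi identity reduces `⁅B, B⁆` to brackets of `⁅B, R⁆ ⊆ R` with `R`.
      simp only [leibniz_lie u]
      exact add_mem (hRR _ (hBR _ hu _ (hx _)) _ (hx _)) (hRR _ (hx _) _ (hBR _ hu _ (hx _)))
  rw [Submodule.span_union]
  apply le_antisymm
  · let K : LieSubalgebra ℂ A :=
      { (R ⊔ B : Submodule ℂ A) with
        lie_mem' := by
          intro a b ha hb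
          change a ∈ R ⊔ B at ha
          change b ∈ R ⊔ B at hb
          change ⁅a, b⁆ ∈ R ⊔ B
          obtain ⟨r, hr, s, hs, rfl⟩ := Submodule.mem_sup.1 ha
          obtain ⟨r', hr', s', hs', rfl⟩ := Submodule.mem_sup.1 hb
          rw [add_lie, lie_add, lie_add]
          refine add_mem (add_mem (Submodule.mem_sup_right (hRR _ hr _ hr'))
            (Submodule.mem_sup_left ?_)) (add_mem (Submodule.mem_sup_left (hBR _ hs _ hr'))
            (Submodule.mem_sup_right (hBB _ hs _ hs')))
          rw [← lie_skew]
          exact neg_mem (hBR _ hs' _ hr) }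
    have : LieSubalgebra.lieSpan ℂ A (Set.range x) ≤ K :=
      LieSubalgebra.lieSpan_le.2 fun a ha => Submodule.mem_sup_left (Submodule.subset_span ha)
    exact this
  · refine sup_le (Submodule.span_le.2 LieSubalgebra.subset_lieSpan) (Submodule.span_le.2 ?_)
    rintro _ ⟨p, rfl⟩
    exact LieSubalgebra.lie_mem _ (LieSubalgebra.subset_lieSpan ⟨p.1, rfl⟩)
      (LieSubalgebra.subset_lieSpan ⟨p.2, rfl⟩)

end TripleSystem

/-! ### Clifford families and the orthogonal Lie algebra -/

section Clifford

variable {A ι : Type*} [Ring A]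

theorem lie_mul_eq_anticommutator (u v w : A) :
    ⁅u * v, w⁆ = u * (v * w + w * v) - (u * w + w * u) * v := by
  rw [Ring.lie_def]
  noncomm_ring

section

variable [DecidableEq ι]

/-- Pairwise anticommuting square roots of one. -/
def IsCliffordFamily (e : ι → A) : Prop :=
  ∀ i j, e i * e j + e j * e i = if i = j then 2 else 0

theorem IsCliffordFamily.mul_comm_of_ne {e : ι → A} (he : IsCliffordFamily e) {i j : ι}
    (h : i ≠ j) : e i * e j = -(e j * e i) := by
  have := he i j
  rw [if_neg h] at this
  exact eq_neg_of_add_eq_zero_left this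

end

variable [Algebra ℂ A]

/-- Vectors whose anticommutators are scalars form a Lie triple system. -/
theorem lie_lie_mem_span_of_anticommutator (x : ι → A) (b : ι → ι → ℂ)
    (h : ∀ i j, x i * x j + x j * x i = algebraMap ℂ A (b i j)) (i j k : ι) :
    ⁅⁅x i, x j⁆, x k⁆ ∈ Submodule.span ℂ (Set.range x) := by
  have key : ⁅⁅x i, x j⁆, x k⁆ = (2 * b j k) • x i - (2 * b i k) • x j := by
    rw [Ring.lie_def (x i), sub_lie, lie_mul_eq_anticommutator, lie_mul_eq_anticommutator, h, h]
    simp only [Algebra.algebraMap_eq_smul_one, mul_smul_comm, smul_mul_assoc, one_mul, mul_one]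
    module
  rw [key]
  exact sub_mem (Submodule.smul_mem _ _ (Submodule.subset_span ⟨i, rfl⟩))
    (Submodule.smul_mem _ _ (Submodule.subset_span ⟨j, rfl⟩))

section

variable [DecidableEq ι]

theorem IsCliffordFamily.mul_self {e : ι → A} (he : IsCliffordFamily e) (i : ι) :
    e i * e i = 1 := by
  have h := he i i
  rw [if_pos rfl, ← two_smul ℂ] at h
  have h2 : (2 : A) = (2 : ℂ) • (1 : A) := by rw [two_smul]; norm_num
  rw [h2] at h
  exact smul_right_injective A (two_ne_zero' ℂ) h

/-- Replace the members `γ i` with `i ≠ o` by `√-1 γ i γ o`. -/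
def twist (γ : ι → A) (o : ι) (i : ι) : A :=
  if i = o then γ o else Complex.I • (γ i * γ o)

theorem twist_self (γ : ι → A) (o : ι) : twist γ o o = γ o := if_pos rfl

theorem twist_of_ne (γ : ι → A) {o i : ι} (h : i ≠ o) :
    twist γ o i = Complex.I • (γ i * γ o) := if_neg h

/-- With `twist_mul_twist_self`, this makes both the `γ i` and the `γ i * γ j` quadratic in the
twisted family. It is the decomposition of `so(n + 1)` into `so(n)` and its vector representation.
-/
theorem twist_mul_twist {γ : ι → A} (hγ : IsCliffordFamily γ) {o i j : ι} (hi : i ≠ o)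
    (hj : j ≠ o) : twist γ o i * twist γ o j = γ i * γ j := by
  rw [twist_of_ne γ hi, twist_of_ne γ hj, smul_mul_smul_comm, Complex.I_mul_I, mul_assoc,
    ← mul_assoc (γ o), hγ.mul_comm_of_ne hj.symm, neg_mul, mul_assoc (γ j), hγ.mul_self]
  simp

theorem twist_mul_twist_self {γ : ι → A} (hγ : IsCliffordFamily γ) {o i : ι} (hi : i ≠ o) :
    twist γ o i * twist γ o o = Complex.I • γ i := by
  rw [twist_of_ne γ hi, twist_self, smul_mul_assoc, mul_assoc, hγ.mul_self, mul_one]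

theorem twist_self_mul_twist {γ : ι → A} (hγ : IsCliffordFamily γ) {o i : ι} (hi : i ≠ o) :
    twist γ o o * twist γ o i = -(Complex.I • γ i) := by
  rw [twist_of_ne γ hi, twist_self, mul_smul_comm, ← mul_assoc, hγ.mul_comm_of_ne hi.symm, neg_mul,
    mul_assoc, hγ.mul_self, mul_one, smul_neg]

theorem isCliffordFamily_twist {γ : ι → A} (hγ : IsCliffordFamily γ) (o : ι) :
    IsCliffordFamily (twist γ o) := by
  intro i j
  rcases eq_or_ne i o with rfl | hi
  · rcases eq_or_ne j i with rfl | hj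
    · rw [twist_self, hγ]
    · rw [twist_mul_twist_self hγ hj, twist_self_mul_twist hγ hj, if_neg hj.symm]
      simp
  · rcases eq_or_ne j o with rfl | hj
    · rw [twist_mul_twist_self hγ hi, twist_self_mul_twist hγ hi, if_neg hi]
      simp
    · rw [twist_mul_twist hγ hi hj, twist_mul_twist hγ hj hi, hγ]

end

variable [Fintype ι]

/-- The map `X ↦ (1/4) ∑ X_ij e_i e_j`. -/
def quadMap (e : ι → A) : Matrix ι ι ℂ →ₗ[ℂ] A where
  toFun X := (1 / 4 : ℂ) • ∑ i, ∑ j, X i j • (e i * e j)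
  map_add' X Y := by
    simp only [Matrix.add_apply, add_smul, Finset.sum_add_distrib, smul_add]
  map_smul' c X := by
    simp only [Matrix.smul_apply, smul_assoc, ← Finset.smul_sum, RingHom.id_apply]
    rw [smul_comm]

theorem quadMap_apply (e : ι → A) (X : Matrix ι ι ℂ) :
    quadMap e X = (1 / 4 : ℂ) • ∑ i, ∑ j, X i j • (e i * e j) := rfl

variable [DecidableEq ι]

/-- Since `⁅e i * e j, e k⁆ = 2 δ_jk e i - 2 δ_ik e j`, the sum consists of two parts that agree by
skew-symmetry; this is what the factor `1 / 4` compensates. -/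
theorem quadMap_lie {e : ι → A} (he : IsCliffordFamily e) {X : Matrix ι ι ℂ}
    (hX : X.transpose = -X) (k : ι) : ⁅quadMap e X, e k⁆ = ∑ i, X i k • e i := by
  have hX' : ∀ i j, X i j = -X j i := fun i j => by
    have := congrFun (congrFun hX j) i
    simpa using this
  have two : (2 : A) = (2 : ℂ) • (1 : A) := by rw [two_smul]; norm_num
  rw [quadMap_apply, smul_lie]
  simp only [LieRing.of_associative_ring_bracket, Finset.sum_mul, Finset.mul_sum]
  simp only [← Finset.sum_sub_distrib, smul_mul_assoc, mul_smul_comm, ← smul_sub]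
  simp only [← LieRing.of_associative_ring_bracket, lie_mul_eq_anticommutator, he _ _, mul_ite,
    ite_mul, mul_zero, zero_mul, smul_sub, smul_ite, smul_zero, Finset.sum_sub_distrib,
    Finset.sum_ite_eq', Finset.mem_univ, if_true]
  rw [Finset.sum_comm (f := fun i j => if i = k then X i j • (2 * e j) else 0)]
  simp only [Finset.sum_ite_eq', Finset.mem_univ, if_true]
  rw [← smul_sub, ← Finset.sum_sub_distrib, Finset.smul_sum]
  refine Finset.sum_congr rfl fun i _ => ?_
  rw [hX' k i, two]
  simp only [mul_smul_comm, smul_mul_assoc, one_mul, mul_one]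
  module

/-- The bracket with `quadMap e X` is a derivation, so its values on the `e k` determine it on
products. The two Leibniz terms give `X * Y` and `Y * X.transpose`. -/
theorem quadMap_lie_quadMap {e : ι → A} (he : IsCliffordFamily e) {X Y : Matrix ι ι ℂ}
    (hX : X.transpose = -X) :
    ⁅quadMap e X, quadMap e Y⁆ = quadMap e (X * Y - Y * X) := by
  have hder : ∀ u v w : A, ⁅u, v * w⁆ = ⁅u, v⁆ * w + v * ⁅u, w⁆ := fun u v w => by
    simp only [Ring.lie_def]
    noncomm_ring
  have hXY : X * Y - Y * X = X * Y + Y * X.transpose := by rw [hX]; simp [sub_eq_add_neg]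
  rw [hXY, map_add, quadMap_apply e Y, lie_smul, quadMap_apply e (X * Y), quadMap_apply e (Y * _),
    ← smul_add]
  congr 1
  rw [LieRing.of_associative_ring_bracket, Finset.mul_sum, Finset.sum_mul]
  simp only [Finset.mul_sum, Finset.sum_mul]
  simp only [← Finset.sum_sub_distrib, smul_mul_assoc, mul_smul_comm, ← smul_sub]
  simp only [← LieRing.of_associative_ring_bracket, hder, quadMap_lie he hX, smul_add,
    Finset.sum_add_distrib, Matrix.mul_apply, Matrix.transpose_apply, Finset.sum_mul,
    Finset.mul_sum, Finset.smul_sum, Finset.sum_smul, smul_mul_assoc, mul_smul_comm, smul_smul]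
  congr 1
  · conv_lhs => enter [2, k]; rw [Finset.sum_comm]
    rw [Finset.sum_comm]
    refine Finset.sum_congr rfl fun m _ => ?_
    rw [Finset.sum_comm]
    exact Finset.sum_congr rfl fun l _ => Finset.sum_congr rfl fun k _ => by rw [mul_comm]
  · refine Finset.sum_congr rfl fun k _ => ?_
    rw [Finset.sum_comm]

/-- The action of the orthogonal Lie algebra defined by a Clifford family. -/
def cliffordHom {e : ι → A} (he : IsCliffordFamily e) :
    LieAlgebra.Orthogonal.so ι ℂ →ₗ⁅ℂ⁆ A :=
  { (quadMap e).comp (LieAlgebra.Orthogonal.so ι ℂ).toSubmodule.subtype with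
    map_lie' := by
      intro X Y
      change quadMap e (X.1 * Y.1 - Y.1 * X.1) = ⁅quadMap e X.1, quadMap e Y.1⁆
      rw [quadMap_lie_quadMap he ((LieAlgebra.Orthogonal.mem_so _ _ _).1 X.2)] }

theorem cliffordHom_apply {e : ι → A} (he : IsCliffordFamily e)
    (X : LieAlgebra.Orthogonal.so ι ℂ) : cliffordHom he X = quadMap e X.1 := rfl

theorem cliffordHom_injective [Nontrivial A] {e : ι → A} (he : IsCliffordFamily e) :
    Function.Injective (cliffordHom he) := by
  rw [injective_iff_map_eq_zero]
  intro X hX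
  rw [cliffordHom_apply] at hX
  ext j k
  have h := quadMap_lie he ((LieAlgebra.Orthogonal.mem_so _ _ _).1 X.2) k
  rw [hX, zero_lie] at h
  have h2 : ∑ i, X.1 i k • (e i * e j + e j * e i) = 0 := by
    -- Anticommuting with `e j` extracts the single coefficient `2 * X j k`.
    have h3 := congrArg (fun a => a * e j + e j * a) h
    simpa only [Finset.sum_mul, Finset.mul_sum, ← Finset.sum_add_distrib, smul_mul_assoc,
      mul_smul_comm, ← smul_add, zero_mul, mul_zero, add_zero, eq_comm] using h3
  simp only [he _ _, smul_ite, smul_zero, Finset.sum_ite_eq', Finset.mem_univ, if_true] at h2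
  have two : (2 : A) = (2 : ℂ) • (1 : A) := by rw [two_smul]; norm_num
  rw [two] at h2
  simpa using h2

theorem mul_mem_cliffordHom_range {e : ι → A} (he : IsCliffordFamily e) {i j : ι} (hij : i ≠ j) :
    e i * e j ∈ (cliffordHom he).range := by
  -- The factor 2 is needed because `E_ij - E_ji` is sent to `(1/2) e_i e_j`.
  have hmem : (2 : ℂ) • (Matrix.single i j (1 : ℂ) - Matrix.single j i 1) ∈
      LieAlgebra.Orthogonal.so ι ℂ := by
    rw [LieAlgebra.Orthogonal.mem_so]
    simp [smul_sub]
  have hs : ∀ a b : ι, quadMap e (Matrix.single a b (1 : ℂ)) = (1 / 4 : ℂ) • (e a * e b) := by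
    intro a b
    rw [quadMap_apply]
    simp [Matrix.single_apply, ite_and, Finset.sum_ite_eq]
  have key : quadMap e ((2 : ℂ) • (Matrix.single i j (1 : ℂ) - Matrix.single j i 1)) =
      e i * e j := by
    rw [map_smul, map_sub, hs, hs, he.mul_comm_of_ne hij.symm]
    module
  exact (LieHom.mem_range _ _).2 ⟨⟨_, hmem⟩, (cliffordHom_apply he _).trans key⟩

theorem cliffordHom_range_le {e : ι → A} (he : IsCliffordFamily e) {K : LieSubalgebra ℂ A}
    (h : ∀ i j, i ≠ j → e i * e j ∈ K) : (cliffordHom he).range ≤ K := by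
  rintro _ ⟨X, rfl⟩
  change quadMap e X.1 ∈ K.toSubmodule
  rw [quadMap_apply]
  refine Submodule.smul_mem _ _ (Submodule.sum_mem _ fun i _ => Submodule.sum_mem _ fun j _ => ?_)
  rcases eq_or_ne i j with rfl | hij
  · have h1 := congrFun (congrFun ((LieAlgebra.Orthogonal.mem_so _ _ _).1 X.2) i) i
    have h2 : X.1 i i = 0 := self_eq_neg.1 (by simpa using h1)
    rw [h2, zero_smul]
    exact Submodule.zero_mem _
  · exact Submodule.smul_mem _ _ (h i j hij)

/-- The algebra homomorphism from the Clifford algebra given by a Clifford family. -/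
def cliffordLift {n : ℕ} {e : Fin n → A} (he : IsCliffordFamily e) :
    CliffordAlgebra (sumSq n) →ₐ[ℂ] A :=
  CliffordAlgebra.lift (sumSq n) ⟨Fintype.linearCombination ℂ e, by
    intro v
    have two : (2 : A) = (2 : ℂ) • (1 : A) := by rw [two_smul]; norm_num
    -- Doubling the square of a vector symmetrizes the double sum, so that only anticommutators
    -- occur.
    apply smul_right_injective A (two_ne_zero' ℂ)
    simp only [Fintype.linearCombination_apply, sumSq, QuadraticMap.weightedSumSquares_apply]
    have h : ∑ i, ∑ j, (v i * v j) • (e i * e j + e j * e i) =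
        (2 : ℂ) • algebraMap ℂ A (∑ i, v i * v i) := by
      simp only [he _ _, smul_ite, smul_zero, Finset.sum_ite_eq, Finset.mem_univ, if_true, two]
      rw [Algebra.algebraMap_eq_smul_one, Finset.sum_smul, Finset.smul_sum]
      exact Finset.sum_congr rfl fun i _ => smul_comm _ _ _
    simp only [one_smul]
    rw [← h, two_smul ℂ]
    simp only [smul_add, Finset.sum_add_distrib, Finset.sum_mul, Finset.mul_sum,
      smul_mul_smul_comm]
    congr 1
    rw [Finset.sum_comm]
    exact Finset.sum_congr rfl fun i _ => Finset.sum_congr rfl fun j _ => by rw [mul_comm (v i)]⟩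

theorem cliffordLift_ι_single {n : ℕ} {e : Fin n → A} (he : IsCliffordFamily e) (i : Fin n) :
    cliffordLift he (CliffordAlgebra.ι (sumSq n) (Pi.single i 1)) = e i := by
  simp [cliffordLift, Fintype.linearCombination_apply_single]

theorem cliffordLift_soToClifford {n : ℕ} {e : Fin n → A} (he : IsCliffordFamily e)
    (X : LieAlgebra.Orthogonal.so (Fin n) ℂ) :
    cliffordLift he (soToClifford n X) = cliffordHom he X := by
  simp [soToClifford, cliffordHom_apply, quadMap_apply, cliffordLift_ι_single]

end Clifford

/-! ### Ladder systems and the Jordan-Wigner transformation -/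

/-- Raising and lowering operators `a (± 1) k` and parities `Z (k + 1)` of the two-level systems
`k < N`, commuting for different systems. -/
structure LadderSystem (A : Type*) [Ring A] [Algebra ℂ A] (N : ℕ) where
  /-- the raising and lowering operators -/
  a : ℤˣ → ℕ → A
  /-- the parities, numbered from one -/
  Z : ℕ → A
  Z_commute : ∀ i j, Commute (Z i) (Z j)
  Z_mul_self : ∀ i, Z i * Z i = 1
  a_mul_self : ∀ ε {k}, k < N → a ε k * a ε k = 0
  a_mul_neg_add : ∀ ε {k}, k < N → a ε k * a (-ε) k + a (-ε) k * a ε k = 1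
  a_mul_neg_sub : ∀ ε {k}, k < N →
    a ε k * a (-ε) k - a (-ε) k * a ε k = (-((ε : ℤ) : ℂ)) • Z (k + 1)
  a_commute : ∀ ε δ {k l}, k < N → l < N → k ≠ l → Commute (a ε k) (a δ l)
  Z_commute_a : ∀ ε {k l}, k < N → l < N → k ≠ l → Commute (Z (k + 1)) (a ε l)
  Z_mul_a : ∀ ε {k}, k < N → Z (k + 1) * a ε k = (-((ε : ℤ) : ℂ)) • a ε k
  a_mul_Z : ∀ ε {k}, k < N → a ε k * Z (k + 1) = ((ε : ℤ) : ℂ) • a ε k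

theorem unit_smul_unit_smul {V : Type*} [AddCommGroup V] [Module ℂ V] (ε : ℤˣ) (v : V) :
    ((ε : ℤ) : ℂ) • ((ε : ℤ) : ℂ) • v = v := by
  rcases Int.units_eq_one_or ε with rfl | rfl <;> simp

theorem units_eq_or_eq_neg (ε δ : ℤˣ) : δ = ε ∨ δ = -ε := by
  rcases Int.units_eq_one_or ε with rfl | rfl <;> rcases Int.units_eq_one_or δ with rfl | rfl <;>
    simp

namespace LadderSystem

variable {A : Type*} [Ring A] [Algebra ℂ A] {N : ℕ} (S : LadderSystem A N)

/-- The product `Z a * ⋯ * Z b`. -/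
def zProd (a b : ℕ) : A := ((List.Ico a (b + 1)).map S.Z).prod

theorem zProd_succ (a b : ℕ) (h : a ≤ b + 1) : S.zProd a (b + 1) = S.zProd a b * S.Z (b + 1) := by
  simp [zProd, List.Ico.succ_top h]

theorem zProd_eq_one {a b : ℕ} (h : b < a) : S.zProd a b = 1 := by
  simp [zProd, List.Ico.eq_nil_of_le h]

/-- This isolates `Z (l + 1)`, the one factor that does not commute with `a δ l`. -/
theorem zProd_split {k l : ℕ} (h : l < k) :
    S.zProd 1 k = S.zProd 1 l * (S.Z (l + 1) * S.zProd (l + 2) k) := by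
  have h1 : List.Ico 1 (k + 1) = List.Ico 1 (l + 1) ++ List.Ico (l + 1) (k + 1) :=
    (List.Ico.append_consecutive (by omega) (by omega)).symm
  have h2 : List.Ico (l + 1) (k + 1) = (l + 1) :: List.Ico (l + 2) (k + 1) :=
    List.Ico.eq_cons (by omega)
  simp [zProd, h1, h2]

theorem commute_zProd {x : A} {a b : ℕ} (h : ∀ i, a ≤ i → i ≤ b → Commute x (S.Z i)) :
    Commute x (S.zProd a b) := by
  refine Commute.list_prod_right _ _ fun y hy => ?_
  obtain ⟨i, hi, rfl⟩ := List.mem_map.1 hy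
  rw [List.Ico.mem] at hi
  exact h i hi.1 (by omega)

theorem Z_commute_zProd (i a b : ℕ) : Commute (S.Z i) (S.zProd a b) :=
  S.commute_zProd fun _ _ _ => S.Z_commute _ _

theorem zProd_commute (a b a' b' : ℕ) : Commute (S.zProd a b) (S.zProd a' b') :=
  S.commute_zProd fun _ _ _ => (S.Z_commute_zProd _ _ _).symm

theorem zProd_mul_self (k : ℕ) : S.zProd 1 k * S.zProd 1 k = 1 := by
  induction k with
  | zero => simp [zProd_eq_one]
  | succ k ih =>
    rw [S.zProd_succ 1 k (by omega), mul_assoc, ← mul_assoc (S.Z (k + 1)),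
      (S.Z_commute_zProd _ _ _).eq, mul_assoc (S.zProd 1 k), S.Z_mul_self, mul_one, ih]

theorem a_commute_zProd (ε : ℤˣ) {k a b : ℕ} (hk : k < N) (ha : 1 ≤ a)
    (hb : b ≤ N) (h : k + 1 < a ∨ b ≤ k) : Commute (S.a ε k) (S.zProd a b) := by
  refine S.commute_zProd fun i h1 h2 => ?_
  obtain ⟨j, rfl⟩ : ∃ j, i = j + 1 := ⟨i - 1, by omega⟩
  exact (S.Z_commute_a ε (by omega) hk (by omega)).symm

/-- The fermionic creation and annihilation operators of the Jordan-Wigner transformation. -/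
def ferm (ε : ℤˣ) (k : ℕ) : A := S.zProd 1 k * S.a ε k

/-- The normal form of a product of two fermionic operators. -/
def fermPair (ε δ : ℤˣ) (k l : ℕ) : A := S.zProd (l + 2) k * (S.a δ l * S.a ε k)

/-- The bit shift operators. -/
def shift (ε : ℤˣ) (k : ℕ) : A :=
  if k = 1 then S.ferm ε 0 else S.fermPair ε (-ε) (k - 1) (k - 2)

/-- The Lie algebra generated by the bit shift operators with index at most `M`. -/
def oddSpin (M : ℕ) : LieSubalgebra ℂ A :=
  LieSubalgebra.lieSpan ℂ A {x | ∃ k : ℕ, ∃ ε : ℤˣ, 1 ≤ k ∧ k ≤ M ∧ x = S.shift ε k}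

/-- The additional generator of the even spin algebra. -/
def evenGen : A := S.ferm 1 (N - 1) + S.ferm (-1) (N - 1)

/-- The Lie algebra generated by `oddSpin (N - 1)` and `evenGen`. -/
def evenSpin : LieSubalgebra ℂ A :=
  LieSubalgebra.lieSpan ℂ A ((S.oddSpin (N - 1) : Set A) ∪ {S.evenGen})

/-- The elements of the basis of `oddSpin M`. -/
def oddElement {M : ℕ} : OddIndex M → A
  | .parity i => S.Z (i + 1)
  | .single ε k => S.ferm ε k
  | .pair ε δ k l _ => S.fermPair ε δ k l

/-- The elements of the basis of `evenSpin`. -/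
def evenElement : EvenIndex N → A
  | .odd a => S.oddElement a
  | .gen => S.evenGen
  | .mixed ε l => S.fermPair 1 ε (N - 1) l + S.fermPair (-1) ε (N - 1) l

/-- The parities below `l` cancel. Here `Z (l + 1)` ends up to the left of `a δ l` and contributes
`-δ`; in the opposite order of the factors it stands to the right and contributes `δ`. This sign
difference is the anticommutation. -/
theorem ferm_mul_ferm_of_gt (ε δ : ℤˣ) {k l : ℕ} (hk : k < N) (h : l < k) :
    S.ferm ε k * S.ferm δ l = (-((δ : ℤ) : ℂ)) • S.fermPair ε δ k l := by
  have hl : l < N := h.trans hk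
  have h1 : S.a ε k * S.zProd 1 l = S.zProd 1 l * S.a ε k :=
    (S.a_commute_zProd ε hk le_rfl hl.le (Or.inr h.le)).eq
  have h2 := (S.zProd_commute (l + 2) k 1 l).eq
  have h3 := (S.Z_commute_zProd (l + 1) 1 l).eq
  have h4 := (S.Z_commute_zProd (l + 1) (l + 2) k).eq
  have h5 : S.a ε k * S.a δ l = S.a δ l * S.a ε k :=
    (S.a_commute ε δ hk hl h.ne').eq
  calc S.ferm ε k * S.ferm δ l
      = S.zProd 1 k * (S.a ε k * S.zProd 1 l) * S.a δ l := by
        simp only [ferm, mul_assoc]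
    _ = S.zProd 1 l * (S.Z (l + 1) * (S.zProd (l + 2) k * S.zProd 1 l)) *
          (S.a ε k * S.a δ l) := by
        rw [h1, S.zProd_split h]; simp only [mul_assoc]
    _ = S.zProd 1 l * (S.Z (l + 1) * S.zProd 1 l) * S.zProd (l + 2) k *
          (S.a δ l * S.a ε k) := by
        rw [h2, h5]; simp only [mul_assoc]
    _ = (S.zProd 1 l * S.zProd 1 l) * (S.Z (l + 1) * S.zProd (l + 2) k) *
          (S.a δ l * S.a ε k) := by
        rw [h3]; simp only [mul_assoc]
    _ = S.zProd (l + 2) k * ((S.Z (l + 1) * S.a δ l) * S.a ε k) := by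
        rw [S.zProd_mul_self, one_mul, h4]; simp only [mul_assoc]
    _ = _ := by
        rw [S.Z_mul_a δ hl, smul_mul_assoc, mul_smul_comm]; rfl

theorem ferm_mul_ferm_of_lt (ε δ : ℤˣ) {k l : ℕ} (hk : k < N) (h : l < k) :
    S.ferm δ l * S.ferm ε k = ((δ : ℤ) : ℂ) • S.fermPair ε δ k l := by
  have hl : l < N := h.trans hk
  have h1 : S.a δ l * S.zProd 1 l = S.zProd 1 l * S.a δ l :=
    (S.a_commute_zProd δ hl le_rfl hl.le (Or.inr le_rfl)).eq
  have h2 : S.a δ l * S.zProd (l + 2) k = S.zProd (l + 2) k * S.a δ l :=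
    (S.a_commute_zProd δ hl (by omega) hk.le (Or.inl (by omega))).eq
  calc S.ferm δ l * S.ferm ε k
      = S.zProd 1 l * (S.a δ l * S.zProd 1 l) *
          (S.Z (l + 1) * S.zProd (l + 2) k) * S.a ε k := by
        rw [ferm, ferm, S.zProd_split h]; simp only [mul_assoc]
    _ = (S.zProd 1 l * S.zProd 1 l) * ((S.a δ l * S.Z (l + 1)) *
          S.zProd (l + 2) k) * S.a ε k := by
        rw [h1]; simp only [mul_assoc]
    _ = ((δ : ℤ) : ℂ) • ((S.a δ l * S.zProd (l + 2) k) * S.a ε k) := by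
        rw [S.zProd_mul_self, one_mul, S.a_mul_Z δ hl]
        simp only [smul_mul_assoc]
    _ = _ := by
        rw [h2, mul_assoc]; rfl

theorem ferm_mul_ferm_self (ε δ : ℤˣ) {k : ℕ} (hk : k < N) :
    S.ferm ε k * S.ferm δ k = S.a ε k * S.a δ k := by
  have h1 : S.a ε k * S.zProd 1 k = S.zProd 1 k * S.a ε k :=
    (S.a_commute_zProd ε hk le_rfl hk.le (Or.inr le_rfl)).eq
  rw [ferm, ferm, mul_assoc, ← mul_assoc (S.a ε k), h1, mul_assoc, ← mul_assoc,
    S.zProd_mul_self, one_mul]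

/-- The canonical anticommutation relations. -/
theorem ferm_anticommutator (ε δ : ℤˣ) {k l : ℕ} (hk : k < N) (hl : l < N) :
    S.ferm ε k * S.ferm δ l + S.ferm δ l * S.ferm ε k =
      algebraMap ℂ _ (if k = l ∧ δ = -ε then 1 else 0) := by
  rcases lt_trichotomy k l with h | rfl | h
  · rw [S.ferm_mul_ferm_of_lt δ ε hl h, S.ferm_mul_ferm_of_gt δ ε hl h]
    simp [h.ne]
  · rw [S.ferm_mul_ferm_self ε δ hk, S.ferm_mul_ferm_self δ ε hk]
    rcases units_eq_or_eq_neg ε δ with rfl | rfl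
    · have : ¬ δ = -δ := fun h => by
        rcases Int.units_eq_one_or δ with rfl | rfl <;> exact absurd h (by decide)
      simp [S.a_mul_self δ hk, this]
    · simp [S.a_mul_neg_add ε hk]
  · rw [S.ferm_mul_ferm_of_lt ε δ hk h, S.ferm_mul_ferm_of_gt ε δ hk h]
    simp [h.ne']

theorem fermPair_eq_mul (ε δ : ℤˣ) {k l : ℕ} (hk : k < N) (h : l < k) :
    S.fermPair ε δ k l = ((δ : ℤ) : ℂ) • (S.ferm δ l * S.ferm ε k) := by
  rw [S.ferm_mul_ferm_of_lt ε δ hk h, unit_smul_unit_smul]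

theorem ferm_lie_ferm_of_lt (ε δ : ℤˣ) {k l : ℕ} (hk : k < N) (h : l < k) :
    ⁅S.ferm δ l, S.ferm ε k⁆ = (2 * ((δ : ℤ) : ℂ)) • S.fermPair ε δ k l := by
  rw [Ring.lie_def, S.ferm_mul_ferm_of_lt ε δ hk h, S.ferm_mul_ferm_of_gt ε δ hk h]
  module

theorem fermPair_eq_lie (ε δ : ℤˣ) {k l : ℕ} (hk : k < N) (h : l < k) :
    S.fermPair ε δ k l = (((δ : ℤ) : ℂ) / 2) • ⁅S.ferm δ l, S.ferm ε k⁆ := by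
  rw [S.ferm_lie_ferm_of_lt ε δ hk h, smul_smul]
  rcases Int.units_eq_one_or δ with rfl | rfl <;> simp

theorem ferm_lie_ferm_neg (ε : ℤˣ) {k : ℕ} (hk : k < N) :
    ⁅S.ferm ε k, S.ferm (-ε) k⁆ = (-((ε : ℤ) : ℂ)) • S.Z (k + 1) := by
  rw [Ring.lie_def, S.ferm_mul_ferm_self _ _ hk, S.ferm_mul_ferm_self _ _ hk, S.a_mul_neg_sub ε hk]

/-- The contraction of the two operators at `l` leaves the one at `k`; with `k = l + 1` this
recovers the fermionic operators recursively from the bit shifts. -/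
theorem fermPair_lie_ferm (ε : ℤˣ) {k l : ℕ} (hk : k < N) (h : l < k) :
    ⁅S.fermPair ε (-ε) k l, S.ferm ε l⁆ = ((ε : ℤ) : ℂ) • S.ferm ε k := by
  have hl := h.trans hk
  rw [S.fermPair_eq_mul ε (-ε) hk h, smul_lie, lie_mul_eq_anticommutator,
    S.ferm_anticommutator _ _ hk hl, S.ferm_anticommutator _ _ hl hl]
  simp [h.ne']

/-! ### Fermionic generators and spanning sets of the two Lie algebras -/

theorem ferm_mem_oddSpin {M : ℕ} (hM : M ≤ N) (ε : ℤˣ) {k : ℕ} (hk : k < M) :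
    S.ferm ε k ∈ S.oddSpin M := by
  have hgen : ∀ (ε : ℤˣ) (k : ℕ), 1 ≤ k → k ≤ M → S.shift ε k ∈ S.oddSpin M :=
    fun ε k h1 h2 => LieSubalgebra.subset_lieSpan ⟨k, ε, h1, h2, rfl⟩
  induction k with
  | zero => exact hgen ε 1 le_rfl (by omega)
  | succ k ih =>
    -- Shifts are numbered from one, digits from zero: the shift of index `k + 2` joins digits `k`
    -- and `k + 1`.
    have h1 := hgen ε (k + 2) (by omega) (by omega)
    change S.fermPair ε (-ε) (k + 1) k ∈ _ at h1
    have h2 := LieSubalgebra.lie_mem _ h1 (ih (by omega))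
    rw [S.fermPair_lie_ferm ε (by omega) k.lt_succ_self] at h2
    rw [← unit_smul_unit_smul ε (S.ferm ε (k + 1))]
    exact LieSubalgebra.smul_mem _ _ h2

theorem oddSpin_eq_lieSpan_ferm {M : ℕ} (hM : M ≤ N) :
    S.oddSpin M = LieSubalgebra.lieSpan ℂ A
      (Set.range fun p : Fin M × ℤˣ => S.ferm p.2 p.1) := by
  apply le_antisymm
  · refine LieSubalgebra.lieSpan_le.2 ?_
    have hf : ∀ (ε : ℤˣ) (k : ℕ), k < M → S.ferm ε k ∈
        LieSubalgebra.lieSpan ℂ A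
          (Set.range fun p : Fin M × ℤˣ => S.ferm p.2 p.1) :=
      fun ε k hk => LieSubalgebra.subset_lieSpan ⟨(⟨k, hk⟩, ε), rfl⟩
    rintro _ ⟨k, ε, h1, h2, rfl⟩
    obtain ⟨k, rfl⟩ : ∃ j, k = j + 1 := ⟨k - 1, by omega⟩
    rcases k with _ | k
    · exact hf ε 0 (by omega)
    · change S.fermPair ε (-ε) (k + 1) k ∈ _
      rw [S.fermPair_eq_lie ε (-ε) (by omega) k.lt_succ_self]
      exact LieSubalgebra.smul_mem _ _ (LieSubalgebra.lie_mem _ (hf _ _ (by omega))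
        (hf _ _ (by omega)))
  · refine LieSubalgebra.lieSpan_le.2 ?_
    rintro _ ⟨p, rfl⟩
    exact S.ferm_mem_oddSpin hM p.2 p.1.2

theorem parityOp_mem_oddSpin {M : ℕ} (hM : M ≤ N) {k : ℕ} (hk : k < M) :
    S.Z (k + 1) ∈ S.oddSpin M := by
  have h := LieSubalgebra.lie_mem _ (S.ferm_mem_oddSpin hM (-1) hk)
    (S.ferm_mem_oddSpin hM (-(-1)) hk)
  rw [S.ferm_lie_ferm_neg (-1) (by omega)] at h
  simpa using h

theorem fermPair_mem_of_ferm_mem {K : LieSubalgebra ℂ A}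
    {ε δ : ℤˣ} {k l : ℕ} (hk : k < N) (h : l < k) (h1 : S.ferm ε k ∈ K) (h2 : S.ferm δ l ∈ K) :
    S.fermPair ε δ k l ∈ K := by
  rw [S.fermPair_eq_lie ε δ hk h]
  exact LieSubalgebra.smul_mem _ _ (LieSubalgebra.lie_mem _ h2 h1)

theorem oddElement_mem_oddSpin {M : ℕ} (hM : M ≤ N) (a : OddIndex M) :
    S.oddElement a ∈ S.oddSpin M := by
  cases a with
  | parity i => exact S.parityOp_mem_oddSpin hM i.2
  | single ε k => exact S.ferm_mem_oddSpin hM ε k.2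
  | pair ε δ k l h =>
    exact S.fermPair_mem_of_ferm_mem (by omega) h (S.ferm_mem_oddSpin hM ε k.2)
      (S.ferm_mem_oddSpin hM δ l.2)

theorem ferm_lie_ferm_mem_span {M : ℕ} (hM : M ≤ N) (ε δ : ℤˣ) (k l : Fin M) :
    ⁅S.ferm ε k, S.ferm δ l⁆ ∈ Submodule.span ℂ (Set.range (S.oddElement (M := M))) := by
  rcases lt_trichotomy k l with h | rfl | h
  · rw [S.ferm_lie_ferm_of_lt δ ε (by omega) h]
    exact Submodule.smul_mem _ _ (Submodule.subset_span ⟨.pair δ ε l k h, rfl⟩)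
  · rcases units_eq_or_eq_neg ε δ with rfl | rfl
    · simp
    · rw [S.ferm_lie_ferm_neg ε (by omega)]
      exact Submodule.smul_mem _ _ (Submodule.subset_span ⟨.parity k, rfl⟩)
  · rw [← lie_skew, S.ferm_lie_ferm_of_lt ε δ (by omega) h]
    exact neg_mem (Submodule.smul_mem _ _ (Submodule.subset_span ⟨.pair ε δ k l h, rfl⟩))

theorem span_oddElement {M : ℕ} (hM : M ≤ N) :
    Submodule.span ℂ (Set.range (S.oddElement (M := M))) = (S.oddSpin M).toSubmodule := by
  apply le_antisymm
  · rw [Submodule.span_le]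
    rintro _ ⟨a, rfl⟩
    exact S.oddElement_mem_oddSpin hM a
  · rw [S.oddSpin_eq_lieSpan_ferm hM, lieSpan_toSubmodule_of_triple _
      (lie_lie_mem_span_of_anticommutator _ _ fun i j : Fin M × ℤˣ =>
        S.ferm_anticommutator i.2 j.2 (i.1.2.trans_le hM) (j.1.2.trans_le hM)), Submodule.span_le]
    rintro _ (⟨p, rfl⟩ | ⟨p, rfl⟩)
    · exact Submodule.subset_span ⟨.single p.2 p.1, rfl⟩
    · exact S.ferm_lie_ferm_mem_span hM _ _ _ _

/-- The generators of `d_N` as a Lie triple system. -/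
def evenVec : Option (Fin (N - 1) × ℤˣ) → A
  | none => S.evenGen
  | some p => S.ferm p.2 p.1

theorem evenSpin_eq_lieSpan :
    S.evenSpin = LieSubalgebra.lieSpan ℂ A (Set.range (S.evenVec)) := by
  apply le_antisymm
  · refine LieSubalgebra.lieSpan_le.2 (Set.union_subset ?_ ?_)
    · rw [SetLike.coe_subset_coe, S.oddSpin_eq_lieSpan_ferm (Nat.sub_le N 1)]
      refine LieSubalgebra.lieSpan_mono ?_
      rintro _ ⟨p, rfl⟩
      exact ⟨some p, rfl⟩
    · exact Set.singleton_subset_iff.2 (LieSubalgebra.subset_lieSpan ⟨none, rfl⟩)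
  · refine LieSubalgebra.lieSpan_le.2 ?_
    rintro _ ⟨_ | p, rfl⟩
    · exact LieSubalgebra.subset_lieSpan (Or.inr rfl)
    · exact LieSubalgebra.subset_lieSpan
        (Or.inl (S.ferm_mem_oddSpin (Nat.sub_le N 1) p.2 p.1.2))

theorem oddSpin_le_evenSpin : S.oddSpin (N - 1) ≤ S.evenSpin :=
  fun _ h => LieSubalgebra.subset_lieSpan (Or.inl h)

theorem evenGen_mem_evenSpin : S.evenGen ∈ S.evenSpin :=
  LieSubalgebra.subset_lieSpan (Or.inr rfl)

theorem evenSpin_le_oddSpin (hN : 0 < N) : S.evenSpin ≤ S.oddSpin N := by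
  rw [S.evenSpin_eq_lieSpan, LieSubalgebra.lieSpan_le]
  rintro _ ⟨_ | p, rfl⟩
  · change S.evenGen ∈ S.oddSpin N
    exact add_mem (S.ferm_mem_oddSpin le_rfl _ (by omega)) (S.ferm_mem_oddSpin le_rfl _ (by omega))
  · exact S.ferm_mem_oddSpin le_rfl p.2 (by omega)

theorem evenVec_anticommutator (hN : 0 < N) (i j : Option (Fin (N - 1) × ℤˣ)) :
    ∃ b : ℂ, S.evenVec i * S.evenVec j + S.evenVec j * S.evenVec i = algebraMap ℂ _ b := by
  have hsum : ∀ a b c d : A,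
      (a + b) * (c + d) + (c + d) * (a + b) =
        (a * c + c * a) + (a * d + d * a) + (b * c + c * b) + (b * d + d * b) := by
    intro a b c d
    noncomm_ring
  have hsum' : ∀ a b c : A,
      (a + b) * c + c * (a + b) = (a * c + c * a) + (b * c + c * b) := by
    intro a b c
    noncomm_ring
  have hN' : N - 1 < N := by omega
  have hf : ∀ (ε δ : ℤˣ) {k l : ℕ}, k < N → l < N → ∃ b : ℂ,
      S.ferm ε k * S.ferm δ l + S.ferm δ l * S.ferm ε k = algebraMap ℂ _ b :=
    fun ε δ _ _ hk hl => ⟨_, S.ferm_anticommutator ε δ hk hl⟩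
  rcases i with _ | p <;> rcases j with _ | q <;> simp only [evenVec, evenGen]
  · rw [hsum, S.ferm_anticommutator _ _ hN' hN', S.ferm_anticommutator _ _ hN' hN',
      S.ferm_anticommutator _ _ hN' hN', S.ferm_anticommutator _ _ hN' hN']
    simp only [← map_add]
    exact ⟨_, rfl⟩
  · have hq : (q.1 : ℕ) < N := by omega
    rw [hsum', S.ferm_anticommutator _ _ hN' hq, S.ferm_anticommutator _ _ hN' hq, ← map_add]
    exact ⟨_, rfl⟩
  · have hp : (p.1 : ℕ) < N := by omega
    rw [add_comm, hsum', S.ferm_anticommutator _ _ hN' hp, S.ferm_anticommutator _ _ hN' hp,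
      ← map_add]
    exact ⟨_, rfl⟩
  · exact hf _ _ (by omega) (by omega)

theorem ferm_lie_evenGen (ε : ℤˣ) (l : Fin (N - 1)) :
    ⁅S.ferm ε l, S.evenGen⁆ = (2 * ((ε : ℤ) : ℂ)) • S.evenElement (.mixed ε l) := by
  have hN : N - 1 < N := by have := l.2; omega
  rw [evenElement, evenGen, lie_add, S.ferm_lie_ferm_of_lt _ _ hN l.2, S.ferm_lie_ferm_of_lt _ _ hN l.2,
    smul_add]

theorem evenElement_mem_evenSpin (a : EvenIndex N) : S.evenElement a ∈ S.evenSpin := by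
  cases a with
  | odd a => exact S.oddSpin_le_evenSpin (S.oddElement_mem_oddSpin (Nat.sub_le N 1) a)
  | gen => exact S.evenGen_mem_evenSpin
  | mixed ε l =>
    have h := LieSubalgebra.lie_mem _
      (S.oddSpin_le_evenSpin (S.ferm_mem_oddSpin (Nat.sub_le N 1) ε l.2)) (S.evenGen_mem_evenSpin)
    rw [S.ferm_lie_evenGen] at h
    have h2 := LieSubalgebra.smul_mem _ (((ε : ℤ) : ℂ) / 2) h
    rw [smul_smul] at h2
    rcases Int.units_eq_one_or ε with rfl | rfl <;> simpa using h2

/-- The generators contribute the `single` elements and `gen`; their brackets contribute the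
parities, pairs and `mixed` elements. -/
theorem span_evenElement (hN : 0 < N) :
    Submodule.span ℂ (Set.range (S.evenElement)) = (S.evenSpin).toSubmodule := by
  apply le_antisymm
  · rw [Submodule.span_le]
    rintro _ ⟨a, rfl⟩
    exact S.evenElement_mem_evenSpin a
  · choose b hb using S.evenVec_anticommutator hN
    rw [S.evenSpin_eq_lieSpan, lieSpan_toSubmodule_of_triple _
      (lie_lie_mem_span_of_anticommutator _ b hb), Submodule.span_le]
    have hmixed : ∀ p : Fin (N - 1) × ℤˣ, ⁅S.ferm p.2 p.1, S.evenGen⁆ ∈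
        Submodule.span ℂ (Set.range (S.evenElement)) := fun p => by
      rw [S.ferm_lie_evenGen]
      exact Submodule.smul_mem _ _ (Submodule.subset_span ⟨_, rfl⟩)
    rintro _ (⟨_ | p, rfl⟩ | ⟨⟨_ | p, _ | q⟩, rfl⟩)
    · exact Submodule.subset_span ⟨.gen, rfl⟩
    · exact Submodule.subset_span ⟨.odd (.single p.2 p.1), rfl⟩
    · simp
    · simp only [evenVec]
      rw [← lie_skew]
      exact neg_mem (hmixed q)
    · exact hmixed p
    · refine Submodule.span_mono ?_ (S.ferm_lie_ferm_mem_span (Nat.sub_le N 1) p.2 q.2 p.1 q.1)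
      rintro _ ⟨a, rfl⟩
      exact ⟨.odd a, rfl⟩

end LadderSystem

/-! ### The Clifford family of the even spin algebra -/

theorem IsCliffordFamily.comp_injective {A ι κ : Type*} [Ring A] [DecidableEq ι] [DecidableEq κ]
    {e : ι → A} (he : IsCliffordFamily e) {f : κ → ι} (hf : Function.Injective f) :
    IsCliffordFamily (e ∘ f) := by
  intro i j
  simp only [Function.comp_apply, he (f i) (f j), hf.eq_iff]

namespace LadderSystem

variable {A : Type*} [Ring A] [Algebra ℂ A] {N : ℕ} (S : LadderSystem A N)

/-- The self-adjoint combinations of the fermionic operators. -/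
def gamma (j : Fin N × Bool) : A :=
  if j.2 then Complex.I • S.ferm 1 j.1 + (-Complex.I) • S.ferm (-1) j.1
  else (1 : ℂ) • S.ferm 1 j.1 + (1 : ℂ) • S.ferm (-1) j.1

/-- For each digit the form is `x * y' + y * x'`, for which `(1, 1)` and `(√-1, -√-1)` are
orthogonal with value 2; hence the coefficients in `gamma`. -/
theorem ferm_combination_anticommutator (x y x' y' : ℂ) {k l : ℕ} (hk : k < N) (hl : l < N) :
    (x • S.ferm 1 k + y • S.ferm (-1) k) * (x' • S.ferm 1 l + y' • S.ferm (-1) l) +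
      (x' • S.ferm 1 l + y' • S.ferm (-1) l) * (x • S.ferm 1 k + y • S.ferm (-1) k) =
      algebraMap ℂ A (if k = l then x * y' + y * x' else 0) := by
  have h : ∀ a b c d : A, (x • a + y • b) * (x' • c + y' • d) + (x' • c + y' • d) * (x • a + y • b) =
      (x * x') • (a * c + c * a) + (x * y') • (a * d + d * a) + (y * x') • (b * c + c * b) +
        (y * y') • (b * d + d * b) := by
    intro a b c d
    simp only [add_mul, mul_add, smul_mul_smul_comm]
    module
  have h1 : (1 : ℤˣ) ≠ -1 := by decide
  rw [h, S.ferm_anticommutator _ _ hk hl, S.ferm_anticommutator _ _ hk hl,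
    S.ferm_anticommutator _ _ hk hl, S.ferm_anticommutator _ _ hk hl]
  by_cases hkl : k = l
  · simp [hkl, h1, h1.symm, Algebra.algebraMap_eq_smul_one, add_smul]
  · simp [hkl]

theorem isCliffordFamily_gamma : IsCliffordFamily S.gamma := by
  have two : algebraMap ℂ A 2 = 2 := map_ofNat _ 2
  rintro ⟨k, s⟩ ⟨l, t⟩
  rcases s with _ | _ <;> rcases t with _ | _ <;>
    simp only [gamma, if_true, if_false, Bool.false_eq_true,
      S.ferm_combination_anticommutator _ _ _ _ k.2 l.2, Prod.mk.injEq, reduceCtorEq, and_false,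
      and_true, Fin.val_inj] <;>
    split_ifs <;> simp [one_add_one_eq_two, two]

theorem ferm_one_eq (k : Fin N) :
    S.ferm 1 k = (1 / 2 : ℂ) • (S.gamma (k, false) + (-Complex.I) • S.gamma (k, true)) := by
  simp only [gamma, if_true, if_false, Bool.false_eq_true, smul_add, smul_smul, neg_mul, mul_neg,
    Complex.I_mul_I]
  module

theorem ferm_neg_one_eq (k : Fin N) :
    S.ferm (-1) k = (1 / 2 : ℂ) • (S.gamma (k, false) + Complex.I • S.gamma (k, true)) := by
  simp only [gamma, if_true, if_false, Bool.false_eq_true, smul_add, smul_smul, mul_neg,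
    Complex.I_mul_I]
  module

theorem ferm_mem_of_gamma_mem {K : Submodule ℂ A} (k : Fin N) (h : ∀ s, S.gamma (k, s) ∈ K)
    (ε : ℤˣ) : S.ferm ε k ∈ K := by
  rcases Int.units_eq_one_or ε with rfl | rfl
  · rw [ferm_one_eq]
    exact K.smul_mem _ (K.add_mem (h _) (K.smul_mem _ (h _)))
  · rw [ferm_neg_one_eq]
    exact K.smul_mem _ (K.add_mem (h _) (K.smul_mem _ (h _)))

theorem gamma_mem_of_ferm_mem {K : Submodule ℂ A} (k : Fin N) (h : ∀ ε, S.ferm ε k ∈ K)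
    (s : Bool) : S.gamma (k, s) ∈ K := by
  unfold gamma
  split_ifs <;> exact K.add_mem (K.smul_mem _ (h _)) (K.smul_mem _ (h _))

/-- The index of the vector whose products with the others give the generators of `evenSpin`. -/
def lastIndex (hN : 0 < N) : Fin N × Bool := (⟨N - 1, by omega⟩, true)

theorem gamma_last_false (hN : 0 < N) : S.gamma (⟨N - 1, by omega⟩, false) = S.evenGen := by
  simp [gamma, evenGen]

theorem gamma_mem_evenSpin (hN : 0 < N) {j : Fin N × Bool} (hj : j ≠ lastIndex hN) :
    S.gamma j ∈ S.evenSpin := by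
  have hN' : N - 1 < N := by omega
  obtain ⟨k, s⟩ := j
  by_cases hk : (k : ℕ) < N - 1
  · exact S.gamma_mem_of_ferm_mem (K := S.evenSpin.toSubmodule) k
      (fun ε => S.oddSpin_le_evenSpin (S.ferm_mem_oddSpin (Nat.sub_le N 1) ε hk)) s
  · have hk' : k = ⟨N - 1, hN'⟩ := Fin.ext (by have := k.2; simp only; omega)
    subst hk'
    rcases s with _ | _
    · rw [S.gamma_last_false hN]
      exact S.evenGen_mem_evenSpin
    · exact absurd rfl hj

/-- The Clifford family whose spin representation has the image `evenSpin`. -/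
def evenFamily (hN : 0 < N) : Fin N × Bool → A := twist S.gamma (lastIndex hN)

theorem isCliffordFamily_evenFamily (hN : 0 < N) : IsCliffordFamily (S.evenFamily hN) :=
  isCliffordFamily_twist S.isCliffordFamily_gamma _

theorem gamma_eq_mul (hN : 0 < N) {j : Fin N × Bool} (hj : j ≠ lastIndex hN) :
    S.gamma j = (-Complex.I) • (S.evenFamily hN j * S.evenFamily hN (lastIndex hN)) := by
  rw [evenFamily, twist_mul_twist_self S.isCliffordFamily_gamma hj, smul_smul, neg_mul,
    Complex.I_mul_I, neg_neg, one_smul]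

theorem evenFamily_mul_mem (hN : 0 < N) {i j : Fin N × Bool} (hij : i ≠ j) :
    S.evenFamily hN i * S.evenFamily hN j ∈ S.evenSpin := by
  have hγ := S.isCliffordFamily_gamma
  rw [evenFamily]
  by_cases hi : i = lastIndex hN
  · subst hi
    rw [twist_self_mul_twist hγ hij.symm]
    exact neg_mem (LieSubalgebra.smul_mem _ _ (S.gamma_mem_evenSpin hN hij.symm))
  · by_cases hj : j = lastIndex hN
    · subst hj
      rw [twist_mul_twist_self hγ hi]
      exact LieSubalgebra.smul_mem _ _ (S.gamma_mem_evenSpin hN hi)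
    · have h : S.gamma i * S.gamma j = (1 / 2 : ℂ) • ⁅S.gamma i, S.gamma j⁆ := by
        rw [Ring.lie_def, hγ.mul_comm_of_ne (Ne.symm hij)]
        module
      rw [twist_mul_twist hγ hi hj, h]
      exact LieSubalgebra.smul_mem _ _ (LieSubalgebra.lie_mem _ (S.gamma_mem_evenSpin hN hi)
        (S.gamma_mem_evenSpin hN hj))

theorem cliffordHom_range_eq_evenSpin (hN : 0 < N) {κ : Type*} [Fintype κ] [DecidableEq κ]
    (f : κ ≃ Fin N × Bool) :
    (cliffordHom ((S.isCliffordFamily_evenFamily hN).comp_injective f.injective)).range =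
      S.evenSpin := by
  apply le_antisymm
  · exact cliffordHom_range_le _ fun i j hij => S.evenFamily_mul_mem hN (f.injective.ne hij)
  · set R := (cliffordHom ((S.isCliffordFamily_evenFamily hN).comp_injective f.injective)).range
    have hγ : ∀ j ≠ lastIndex hN, S.gamma j ∈ R := by
      intro j hj
      have hm := mul_mem_cliffordHom_range
        ((S.isCliffordFamily_evenFamily hN).comp_injective f.injective)
        (f.symm.injective.ne hj)
      simp only [Function.comp_apply, Equiv.apply_symm_apply] at hm
      rw [S.gamma_eq_mul hN hj]
      exact LieSubalgebra.smul_mem _ _ hm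
    rw [evenSpin_eq_lieSpan, LieSubalgebra.lieSpan_le]
    rintro _ ⟨_ | p, rfl⟩
    · change S.evenGen ∈ R
      rw [← S.gamma_last_false hN]
      exact hγ _ (by simp [lastIndex])
    · refine S.ferm_mem_of_gamma_mem (K := R.toSubmodule) ⟨p.1, by omega⟩ (fun s => hγ _ ?_) p.2
      have := p.1.2
      simp only [lastIndex, ne_eq, Prod.mk.injEq, Fin.mk.injEq, not_and]
      omega

/-- The Jordan-Wigner transformation can be inverted within the associative algebra generated by the
family; this is the input for simplicity of the Clifford module. -/
theorem Z_mem_and_a_mem (hN : 0 < N) {K : Subalgebra ℂ A} (h : ∀ j, S.evenFamily hN j ∈ K) :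
    (∀ k < N, S.Z (k + 1) ∈ K) ∧ ∀ ε, ∀ k < N, S.a ε k ∈ K := by
  have hγ : ∀ j, S.gamma j ∈ K := by
    intro j
    by_cases hj : j = lastIndex hN
    · subst hj
      simpa [evenFamily, twist_self] using h (lastIndex hN)
    · rw [S.gamma_eq_mul hN hj]
      exact K.smul_mem (K.mul_mem (h _) (h _)) _
  have hf : ∀ ε, ∀ k < N, S.ferm ε k ∈ K := fun ε k hk =>
    S.ferm_mem_of_gamma_mem (K := Subalgebra.toSubmodule K) ⟨k, hk⟩ (fun _ => hγ _) ε
  have hZ : ∀ k < N, S.Z (k + 1) ∈ K := by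
    intro k hk
    have h1 := S.ferm_lie_ferm_neg (-1) hk
    have h2 : S.Z (k + 1) = S.ferm (-1) k * S.ferm (- -1) k - S.ferm (- -1) k * S.ferm (-1) k := by
      rw [← Ring.lie_def, h1]
      simp
    rw [h2]
    exact K.sub_mem (K.mul_mem (hf _ _ hk) (hf _ _ hk)) (K.mul_mem (hf _ _ hk) (hf _ _ hk))
  refine ⟨hZ, fun ε k hk => ?_⟩
  have h1 : S.a ε k = S.zProd 1 k * S.ferm ε k := by
    rw [ferm, ← mul_assoc, zProd_mul_self, one_mul]
  rw [h1]
  refine K.mul_mem (K.list_prod_mem fun x hx => ?_) (hf ε k hk)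
  obtain ⟨i, hi, rfl⟩ := List.mem_map.1 hx
  rw [List.Ico.mem] at hi
  obtain ⟨j, rfl⟩ : ∃ j, i = j + 1 := ⟨i - 1, by omega⟩
  exact hZ j (by omega)

/-- The operator that flips the last two-level system. -/
def flipLast : A := S.a 1 (N - 1) + S.a (-1) (N - 1)

theorem flipLast_mul_self (hN : 0 < N) : S.flipLast * S.flipLast = 1 := by
  have hN' : N - 1 < N := by omega
  simp [flipLast, add_mul, mul_add, S.a_mul_self _ hN', ← S.a_mul_neg_add 1 hN', add_comm]

theorem evenGen_eq_mul : S.evenGen = S.zProd 1 (N - 1) * S.flipLast := by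
  rw [evenGen, flipLast, mul_add, ferm, ferm]

theorem commute_flipLast_of_mem_evenSpin (hN : 0 < N) {x : A} (hx : x ∈ S.evenSpin) :
    Commute S.flipLast x := by
  have hN' : N - 1 < N := by omega
  -- The centralizer is a Lie subalgebra, so it suffices to check the generators.
  let K : LieSubalgebra ℂ A :=
    { Subalgebra.toSubmodule (Subalgebra.centralizer ℂ {S.flipLast}) with
      lie_mem' := fun {x y} hx hy =>
        (Subalgebra.centralizer ℂ {S.flipLast}).sub_mem (Subalgebra.mul_mem _ hx hy)
          (Subalgebra.mul_mem _ hy hx) }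
  have hK : ∀ y, Commute S.flipLast y → y ∈ K := fun y hy =>
    Subalgebra.mem_centralizer_iff ℂ |>.2 fun _ hg => hg ▸ hy.eq
  -- These strings do not contain `Z N`, the parity of the last digit.
  have hz : ∀ {k : ℕ}, k ≤ N - 1 → Commute S.flipLast (S.zProd 1 k) := fun hk =>
    (S.a_commute_zProd _ hN' le_rfl (by omega) (Or.inr hk)).add_left
      (S.a_commute_zProd _ hN' le_rfl (by omega) (Or.inr hk))
  have hle : S.evenSpin ≤ K := by
    rw [evenSpin_eq_lieSpan, LieSubalgebra.lieSpan_le]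
    rintro _ ⟨_ | p, rfl⟩
    · refine hK _ ?_
      change Commute S.flipLast S.evenGen
      rw [evenGen_eq_mul]
      exact (hz le_rfl).mul_right (Commute.refl _)
    · refine hK _ ((hz p.1.2.le).mul_right ?_)
      have := p.1.2
      exact (S.a_commute _ _ hN' (by omega) (by omega)).add_left
        (S.a_commute _ _ hN' (by omega) (by omega))
  exact Subalgebra.mem_centralizer_iff ℂ |>.1 (hle hx) _ rfl

end LadderSystem

/-! ### Number of basis elements and dimension of the orthogonal Lie algebra -/

section Counting

/-- The indices of the basis of `oddSpin M`, as a sum of simpler types. -/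
def OddIndex.equivSum (M : ℕ) :
    OddIndex M ≃ Fin M ⊕ (ℤˣ × Fin M) ⊕ (ℤˣ × ℤˣ × Σ k : Fin M, Fin k) where
  toFun
    | .parity i => .inl i
    | .single ε k => .inr (.inl (ε, k))
    | .pair ε δ k l h => .inr (.inr (ε, δ, ⟨k, ⟨l, h⟩⟩))
  invFun
    | .inl i => .parity i
    | .inr (.inl p) => .single p.1 p.2
    | .inr (.inr p) => .pair p.1 p.2.1 p.2.2.1 ⟨p.2.2.2, p.2.2.2.2.trans p.2.2.1.2⟩ p.2.2.2.2
  left_inv a := by cases a <;> rfl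
  right_inv a := by rcases a with _ | _ | _ <;> rfl

/-- The indices of the basis of `evenSpin`, as a sum of simpler types. -/
def EvenIndex.equivSum (N : ℕ) :
    EvenIndex N ≃ OddIndex (N - 1) ⊕ Unit ⊕ (ℤˣ × Fin (N - 1)) where
  toFun
    | .odd a => .inl a
    | .gen => .inr (.inl ())
    | .mixed ε l => .inr (.inr (ε, l))
  invFun
    | .inl a => .odd a
    | .inr (.inl _) => .gen
    | .inr (.inr p) => .mixed p.1 p.2
  left_inv a := by cases a <;> rfl
  right_inv a := by rcases a with _ | _ | _ <;> rfl

instance (M : ℕ) : Fintype (OddIndex M) := Fintype.ofEquiv _ (OddIndex.equivSum M).symm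

instance (N : ℕ) : Fintype (EvenIndex N) := Fintype.ofEquiv _ (EvenIndex.equivSum N).symm

theorem card_sigma_fin_mul_two (n : ℕ) :
    Fintype.card (Σ k : Fin n, Fin k) * 2 = n * (n - 1) := by
  rw [Fintype.card_sigma]
  simp only [Fintype.card_fin]
  rw [Fin.sum_univ_eq_sum_range (fun i => i), Finset.sum_range_id_mul_two]

/-- Both sides are `N * (2 * N - 1)`; with `M = N - 1` the left one is `(2 * M ^ 2 + M) + 1 + 2 *
M`. -/
theorem card_evenIndex {N : ℕ} (hN : 0 < N) :
    Fintype.card (EvenIndex N) = Fintype.card (Σ k : Fin (2 * N), Fin k) := by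
  obtain ⟨n, rfl⟩ : ∃ n, N = n + 1 := ⟨N - 1, by omega⟩
  have h2 : Fintype.card ℤˣ = 2 := rfl
  have hodd := Fintype.card_congr (OddIndex.equivSum (n + 1 - 1))
  rw [Fintype.card_congr (EvenIndex.equivSum (n + 1))]
  simp only [Fintype.card_sum, Fintype.card_prod, h2, Fintype.card_fin, Fintype.card_unit,
    Nat.add_sub_cancel] at hodd ⊢
  rw [hodd]
  have h3 : Fintype.card (Σ k : Fin (n + 1 - 1), Fin k) * 2 = n * (n - 1) :=
    card_sigma_fin_mul_two n
  generalize Fintype.card (Σ k : Fin (n + 1 - 1), Fin k) = c at h3 ⊢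
  have h4 := card_sigma_fin_mul_two (2 * (n + 1))
  have h5 : 2 * (n + 1) - 1 = 2 * n + 1 := by omega
  rw [h5] at h4
  -- The case zero is separate because of the truncated `n - 1` in `h3`.
  rcases n with _ | n
  · simp only [zero_mul] at h3
    omega
  · rw [Nat.add_sub_cancel] at h3
    nlinarith

/-- The entries of the skew-symmetric matrix with given entries above the diagonal. -/
def skewEntry {n : ℕ} (f : (Σ k : Fin n, Fin k) → ℂ) (i j : Fin n) : ℂ :=
  if h : i < j then f ⟨j, ⟨i, h⟩⟩ else if h : j < i then -f ⟨i, ⟨j, h⟩⟩ else 0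

theorem skewEntry_of_lt {n : ℕ} (f : (Σ k : Fin n, Fin k) → ℂ) {i j : Fin n} (h : i < j) :
    skewEntry f i j = f ⟨j, ⟨i, h⟩⟩ := dif_pos h

theorem skewEntry_swap {n : ℕ} (f : (Σ k : Fin n, Fin k) → ℂ) (i j : Fin n) :
    skewEntry f j i = -skewEntry f i j := by
  rcases lt_trichotomy i j with h | rfl | h
  · simp [skewEntry, h, h.not_gt]
  · simp [skewEntry]
  · simp [skewEntry, h, h.not_gt]

/-- The skew-symmetric matrix with given entries above the diagonal. -/
def skewOfUpper (n : ℕ) :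
    ((Σ k : Fin n, Fin k) → ℂ) →ₗ[ℂ] (LieAlgebra.Orthogonal.so (Fin n) ℂ).toSubmodule :=
  LinearMap.codRestrict _
    { toFun := fun f => Matrix.of (skewEntry f)
      map_add' := fun f g => Matrix.ext fun i j => by
        rw [Matrix.add_apply, Matrix.of_apply, Matrix.of_apply, Matrix.of_apply]
        unfold skewEntry
        split_ifs
        · rfl
        · rw [Pi.add_apply, neg_add]
        · rw [add_zero]
      map_smul' := fun c f => Matrix.ext fun i j => by
        rw [Matrix.smul_apply, Matrix.of_apply, Matrix.of_apply, RingHom.id_apply]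
        unfold skewEntry
        split_ifs
        · rfl
        · rw [Pi.smul_apply, smul_neg]
        · rw [smul_zero] }
    fun f => (LieAlgebra.Orthogonal.mem_so _ _ _).2 (Matrix.ext fun i j => skewEntry_swap f i j)

theorem skewOfUpper_injective (n : ℕ) : Function.Injective (skewOfUpper n) := by
  intro f g h
  funext ⟨k, i⟩
  have h1 := congrFun (congrFun (congrArg Subtype.val h) ⟨i, i.2.trans k.2⟩) k
  have hlt : (⟨i, i.2.trans k.2⟩ : Fin n) < k := i.2
  change skewEntry f _ _ = skewEntry g _ _ at h1
  rwa [skewEntry_of_lt f hlt, skewEntry_of_lt g hlt] at h1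

theorem card_le_finrank_so (n : ℕ) :
    Fintype.card (Σ k : Fin n, Fin k) ≤
      Module.finrank ℂ (LieAlgebra.Orthogonal.so (Fin n) ℂ).toSubmodule := by
  have := LinearMap.finrank_le_finrank_of_injective (skewOfUpper_injective n)
  rwa [Module.finrank_fintype_fun_eq_card] at this

end Counting

/-! ### Bases, isomorphisms onto the image, and decomposition by an involution -/

theorem exists_basis_lieSubalgebra {A ι : Type*} [LieRing A] [LieAlgebra ℂ A]
    {K : LieSubalgebra ℂ A} {v : ι → A} (hli : LinearIndependent ℂ v)
    (hspan : Submodule.span ℂ (Set.range v) = K.toSubmodule) :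
    ∃ b : Module.Basis ι ℂ K, ∀ i, (b i : A) = v i := by
  let b : Module.Basis ι ℂ K.toSubmodule := (Module.Basis.span hli).map (LinearEquiv.ofEq _ _ hspan)
  refine ⟨b, fun i => ?_⟩
  change ((b i : K.toSubmodule) : A) = v i
  simp [b, Module.Basis.span_apply]

theorem exists_lieEquiv_of_range_eq {L A : Type*} [LieRing L] [LieAlgebra ℂ L] [LieRing A]
    [LieAlgebra ℂ A] {f : L →ₗ⁅ℂ⁆ A} (hf : Function.Injective f) {K : LieSubalgebra ℂ A}
    (hK : f.range = K) : ∃ φ : L ≃ₗ⁅ℂ⁆ K, ∀ x, (φ x : A) = f x := by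
  subst hK
  exact ⟨LieEquiv.ofInjective f hf, fun x => rfl⟩

/-- An involution other than `± 1` decomposes the representations commuting with it. -/
theorem exists_isCompl_invariant {V : Type*} [AddCommGroup V] [Module ℂ V] {C : Module.End ℂ V}
    (hC : ∀ v, C (C v) = v) (h1 : ∃ v, C v ≠ v) (h2 : ∃ v, C v ≠ -v) :
    ∃ U W : Submodule ℂ V, U ≠ ⊥ ∧ W ≠ ⊥ ∧ IsCompl U W ∧
      ∀ A : Module.End ℂ V, (∀ v, C (A v) = A (C v)) →
        (∀ u ∈ U, A u ∈ U) ∧ ∀ w ∈ W, A w ∈ W := by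
  have hU : ∀ v, v ∈ LinearMap.ker (C - 1) ↔ C v = v := fun v => by
    rw [LinearMap.mem_ker, LinearMap.sub_apply, Module.End.one_apply, sub_eq_zero]
  have hW : ∀ v, v ∈ LinearMap.ker (C + 1) ↔ C v = -v := fun v => by
    rw [LinearMap.mem_ker, LinearMap.add_apply, Module.End.one_apply, add_eq_zero_iff_eq_neg]
  have hplus : ∀ v, v + C v ∈ LinearMap.ker (C - 1) := fun v => by
    rw [hU, map_add, hC, add_comm]
  have hminus : ∀ v, v - C v ∈ LinearMap.ker (C + 1) := fun v => by
    rw [hW, map_sub, hC, neg_sub]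
  refine ⟨LinearMap.ker (C - 1), LinearMap.ker (C + 1), ?_, ?_, ⟨?_, ?_⟩, ?_⟩
  · intro h
    obtain ⟨v, hv⟩ := h2
    have := hplus v
    rw [h, Submodule.mem_bot, add_comm] at this
    exact hv (eq_neg_of_add_eq_zero_left this)
  · intro h
    obtain ⟨v, hv⟩ := h1
    have := hminus v
    rw [h, Submodule.mem_bot, sub_eq_zero] at this
    exact hv this.symm
  · rw [Submodule.disjoint_def]
    intro v hv hv'
    rw [hU] at hv
    rw [hW, hv] at hv'
    have h3 : (2 : ℂ) • v = 0 := by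
      rw [two_smul]
      exact add_eq_zero_iff_eq_neg.2 hv'
    exact (smul_eq_zero.1 h3).resolve_left two_ne_zero
  · rw [codisjoint_iff_le_sup]
    intro v _
    -- The projections onto the eigenspaces are `(1 ± C) / 2`.
    have hv : v = (1 / 2 : ℂ) • (v + C v) + (1 / 2 : ℂ) • (v - C v) := by module
    rw [hv]
    exact Submodule.add_mem_sup (Submodule.smul_mem _ _ (hplus v))
      (Submodule.smul_mem _ _ (hminus v))
  · intro A hA
    refine ⟨fun u hu => ?_, fun w hw => ?_⟩
    · rw [hU] at hu ⊢
      rw [hA, hu]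
    · rw [hW] at hw ⊢
      rw [hA, hw, map_neg]

namespace LadderSystem

variable {A : Type*} [Ring A] [Algebra ℂ A] {N : ℕ} (S : LadderSystem A N)

/-- A spanning family with at most as many members as the dimension is independent, so a lower bound
for the dimension of `so(2N)` suffices. -/
theorem linearIndependent_evenElement [Nontrivial A] (hN : 0 < N) :
    LinearIndependent ℂ S.evenElement := by
  rw [linearIndependent_iff_card_le_finrank_span, Set.finrank, S.span_evenElement hN,
    card_evenIndex hN]
  refine (card_le_finrank_so (2 * N)).trans ?_
  let f : Fin (2 * N) ≃ Fin N × Bool := Fintype.equivOfCardEq (by simp [mul_comm])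
  have he := (S.isCliffordFamily_evenFamily hN).comp_injective f.injective
  have hrange : LinearMap.range (cliffordHom he).toLinearMap = S.evenSpin.toSubmodule := by
    rw [← S.cliffordHom_range_eq_evenSpin hN f]
    rfl
  rw [← hrange]
  exact (LinearMap.finrank_range_of_inj (f := (cliffordHom he).toLinearMap)
    (cliffordHom_injective he)).ge

theorem linearIndependent_oddElement [Nontrivial A] (hN : 0 < N) :
    LinearIndependent ℂ (S.oddElement (M := N - 1)) :=
  (S.linearIndependent_evenElement hN).comp EvenIndex.odd fun _ _ h => EvenIndex.odd.inj h

end LadderSystem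

/-! ### Back to binary numbers: identification of operators, simplicity, decomposition -/

/-- The digits of a binary number as a ladder system. -/
def spinSystem (N : ℕ) : LadderSystem (Module.End ℂ (Spinor N)) N where
  a := ladder N
  Z := parityOp N
  Z_commute := parityOp_commute N
  Z_mul_self := parityOp_mul_self N
  a_mul_self ε _ hk := ladder_mul_self ε hk
  a_mul_neg_add ε _ hk := ladder_mul_neg_add ε hk
  a_mul_neg_sub ε _ hk := ladder_mul_neg_sub ε hk
  a_commute ε δ _ _ hk hl hkl := ladder_commute ε δ hk hl hkl
  Z_commute_a ε _ _ hk hl hkl := parityOp_commute_ladder ε hk hl hkl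
  Z_mul_a ε _ hk := parityOp_mul_ladder ε hk
  a_mul_Z ε _ hk := ladder_mul_parityOp ε hk

/-- The two digits of a shift are adjacent, so the string of parities between them is empty. -/
theorem shiftOp_eq {N : ℕ} (ε : ℤˣ) {k : ℕ} (h1 : 1 ≤ k) (h2 : k ≤ N) :
    shiftOp N ε k = (spinSystem N).shift ε k := by
  obtain ⟨k, rfl⟩ : ∃ j, k = j + 1 := ⟨k - 1, by omega⟩
  rcases k with _ | k
  · change shiftOp N ε 1 = (spinSystem N).zProd 1 0 * ladder N ε 0
    rw [LadderSystem.zProd_eq_one _ (by omega), one_mul]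
    simp [shiftOp, ladder]
  · change shiftOp N ε (k + 2) =
      (spinSystem N).zProd (k + 2) (k + 1) * (ladder N (-ε) k * ladder N ε (k + 1))
    rw [LadderSystem.zProd_eq_one _ (by omega), one_mul,
      ← arithOp_pair ε (-ε) (by omega) (by omega) k.lt_succ_self.ne']
    simp [shiftOp]

theorem oddSpin_eq {N M : ℕ} (hM : M ≤ N) : oddSpin N M = (spinSystem N).oddSpin M := by
  have : {A | ∃ k : ℕ, ∃ ε : ℤˣ, 1 ≤ k ∧ k ≤ M ∧ A = shiftOp N ε k} =
      {A | ∃ k : ℕ, ∃ ε : ℤˣ, 1 ≤ k ∧ k ≤ M ∧ A = (spinSystem N).shift ε k} := by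
    ext A
    refine exists_congr fun k => exists_congr fun ε => and_congr_right fun h1 =>
      and_congr_right fun h2 => ?_
    rw [shiftOp_eq ε h1 (h2.trans hM)]
  rw [oddSpin, this]
  rfl

theorem flipTop_eq (N : ℕ) : flipTop N = (spinSystem N).flipLast := by
  change flipTop N = ladder N 1 (N - 1) + ladder N (-1) (N - 1)
  simp [flipTop, ladder]

theorem evenGen_eq (N : ℕ) : evenGen N = (spinSystem N).evenGen := by
  rw [LadderSystem.evenGen_eq_mul, ← flipTop_eq]
  rfl

theorem evenSpin_eq (N : ℕ) : evenSpin N = (spinSystem N).evenSpin := by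
  rw [evenSpin, oddSpin_eq (Nat.sub_le N 1), evenGen_eq]
  rfl

theorem oddElement_eq {N M : ℕ} (hM : M ≤ N) (a : OddIndex M) :
    oddElement N a = (spinSystem N).oddElement a := by
  cases a with
  | parity i => rfl
  | single ε k => rfl
  | pair ε δ k l h =>
    have hlk : (l : ℕ) < k := h
    rw [oddElement, arithOp_pair ε δ (by omega) (by omega) hlk.ne']
    rfl

theorem evenElement_eq {N : ℕ} (a : EvenIndex N) :
    evenElement N a = (spinSystem N).evenElement a := by
  cases a with
  | odd a => exact oddElement_eq (Nat.sub_le N 1) a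
  | gen => exact evenGen_eq N
  | mixed ε l =>
    change parityProd N (l + 2) (N - 1) * ladder N ε l * flipTop N =
      parityProd N (l + 2) (N - 1) * (ladder N ε l * ladder N 1 (N - 1)) +
        parityProd N (l + 2) (N - 1) * (ladder N ε l * ladder N (-1) (N - 1))
    rw [flipTop_eq, ← mul_add, ← mul_add, ← mul_assoc]
    rfl

theorem ladder_add_ladder_single {N : ℕ} (k : Fin N) (m : Bits N) :
    (ladder N 1 k + ladder N (-1) k) (Finsupp.single m 1) = Finsupp.single (flipBit k m) 1 := by
  by_cases h : m k = true <;> simp [ladder_single, h]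

theorem parityOp_apply {N : ℕ} (k : Fin N) (w : Spinor N) (m : Bits N) :
    parityOp N (k + 1) w m = (if m k = true then (-1 : ℂ) else 1) * w m := by
  induction w using Finsupp.induction_linear with
  | zero => simp
  | add u v hu hv => rw [map_add, Finsupp.add_apply, hu, hv, Finsupp.add_apply, mul_add]
  | single m' c =>
    have h : Finsupp.single m' c = c • Finsupp.single m' (1 : ℂ) := by simp
    rw [h, map_smul, parityOp_single]
    rcases eq_or_ne m' m with rfl | hne
    · by_cases hk : m' k = true <;> simp [hk]
    · by_cases hk : m' k = true <;> simp [hk, hne]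

/-- The spinors have no proper nonzero subspace invariant under parities and ladder operators. -/
theorem eq_bot_or_eq_top_of_invariant {N : ℕ} {W : Submodule ℂ (Spinor N)}
    (hZ : ∀ k < N, ∀ w ∈ W, parityOp N (k + 1) w ∈ W)
    (ha : ∀ ε, ∀ k < N, ∀ w ∈ W, ladder N ε k w ∈ W) : W = ⊥ ∨ W = ⊤ := by
  by_cases hW : W = ⊥
  · exact Or.inl hW
  obtain ⟨w, hw, hw0⟩ := W.exists_mem_ne_zero_of_ne_bot hW
  obtain ⟨m, hm⟩ := Finsupp.ne_iff.1 hw0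
  have hflip : ∀ (k : Fin N) (m : Bits N), Finsupp.single m 1 ∈ W →
      Finsupp.single (flipBit k m) 1 ∈ W := fun k m h => by
    rw [← ladder_add_ladder_single]
    exact W.add_mem (ha _ _ k.2 _ h) (ha _ _ k.2 _ h)
  -- The projections `(1 ± Z) / 2` fix one digit after another to that of `m`, a basis vector in the
  -- support of `w`.
  have hfilter : ∀ s : Finset (Fin N), w.filter (fun m' => ∀ k ∈ s, m' k = m k) ∈ W := by
    intro s
    induction s using Finset.induction_on with
    | empty => rwa [(Finsupp.filter_eq_self_iff _ _).2 (by simp)]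
    | insert k s _ ih =>
      set w' := w.filter (fun m' => ∀ k ∈ s, m' k = m k) with hw'
      have h : w.filter (fun m' => ∀ i ∈ insert k s, m' i = m i) = (1 / 2 : ℂ) • (w' +
          (if m k = true then (-1 : ℂ) else 1) • parityOp N (k + 1) w') := by
        ext m'
        rw [Finsupp.smul_apply, Finsupp.add_apply, Finsupp.smul_apply, parityOp_apply, hw',
          Finsupp.filter_apply, Finsupp.filter_apply]
        simp only [Finset.forall_mem_insert]
        by_cases h1 : ∀ i ∈ s, m' i = m i
        · simp only [eq_true h1, and_true, if_true, smul_eq_mul]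
          by_cases h2 : m k = true <;> by_cases h3 : m' k = true <;> simp [h2, h3]
          all_goals ring
        · simp only [eq_false h1, and_false, if_false, mul_zero, smul_zero, add_zero]
      rw [h]
      exact W.smul_mem _ (W.add_mem ih (W.smul_mem _ (hZ k k.2 _ ih)))
  have hsingle : Finsupp.single m (1 : ℂ) ∈ W := by
    have h := W.smul_mem (w m)⁻¹ (hfilter Finset.univ)
    have h2 : (w m)⁻¹ • w.filter (fun m' => ∀ k ∈ Finset.univ, m' k = m k) =
        Finsupp.single m (1 : ℂ) := by
      ext m'
      rw [Finsupp.smul_apply, Finsupp.filter_apply]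
      rcases eq_or_ne m m' with rfl | hne
      · simpa using inv_mul_cancel₀ hm
      · have : ¬ ∀ k ∈ Finset.univ, m' k = m k := fun h =>
          hne (funext fun k => (h k (Finset.mem_univ k)).symm)
        rw [if_neg this]
        simp [hne]
    rwa [h2] at h
  have hall : ∀ m' : Bits N, Finsupp.single m' (1 : ℂ) ∈ W := by
    intro m'
    -- Starting from `m`, the digits are changed to those of `m'` one at a time by flips.
    have h : ∀ s : Finset (Fin N),
        Finsupp.single (fun i => if i ∈ s then m' i else m i) (1 : ℂ) ∈ W := by
      intro s
      induction s using Finset.induction_on with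
      | empty => simpa using hsingle
      | insert k s hk ih =>
        by_cases h : m' k = m k
        · convert ih using 3 with i
          rcases eq_or_ne i k with rfl | hne
          · simp [hk, h]
          · simp [hne]
        · convert hflip k _ ih using 2
          ext i
          rcases eq_or_ne i k with rfl | hne
          · rw [flipBit_self]
            simp only [Finset.mem_insert_self, if_true, hk, if_false]
            exact Bool.eq_not.2 h ▸ rfl
          · rw [flipBit_of_ne hne]
            simp [hne]
    simpa using h Finset.univ
  refine Or.inr (eq_top_iff.2 fun v _ => ?_)
  induction v using Finsupp.induction_linear with
  | zero => exact W.zero_mem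
  | add u v hu hv => exact W.add_mem (hu trivial) (hv trivial)
  | single m' c =>
    have h : Finsupp.single m' c = c • Finsupp.single m' (1 : ℂ) := by simp
    rw [h]
    exact W.smul_mem _ (hall m')

theorem exists_lieEquiv_isSpinRepresentation {N : ℕ} (hN : 0 < N) :
    ∃ φ : LieAlgebra.Orthogonal.so (Fin (2 * N)) ℂ ≃ₗ⁅ℂ⁆ evenSpin N,
      IsSpinRepresentation (N := N) ((evenSpin N).incl.comp φ.toLieHom) := by
  let f : Fin (2 * N) ≃ Fin N × Bool := Fintype.equivOfCardEq (by simp [mul_comm])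
  have he := ((spinSystem N).isCliffordFamily_evenFamily hN).comp_injective f.injective
  have hrange := (spinSystem N).cliffordHom_range_eq_evenSpin hN f
  rw [evenSpin_eq]
  obtain ⟨φ, hφ⟩ := exists_lieEquiv_of_range_eq (cliffordHom_injective he) hrange
  refine ⟨φ, inferInstance, cliffordLift he, fun W hW => ?_, fun X => ?_⟩
  · have hK := (spinSystem N).Z_mem_and_a_mem hN (K := (cliffordLift he).range) fun j =>
      ⟨_, (cliffordLift_ι_single he (f.symm j)).trans (by simp)⟩
    refine eq_bot_or_eq_top_of_invariant (fun k hk w hw => ?_) fun ε k hk w hw => ?_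
    · obtain ⟨x, hx⟩ := hK.1 k hk
      have := hW x w hw
      rwa [show cliffordLift he x = parityOp N (k + 1) from hx] at this
    · obtain ⟨x, hx⟩ := hK.2 ε k hk
      have := hW x w hw
      rwa [show cliffordLift he x = ladder N ε k from hx] at this
  · exact (hφ X).trans (cliffordLift_soToClifford he X).symm

theorem exists_decomposition {N : ℕ} (hN : 0 < N) :
    ∃ U W : Submodule ℂ (Spinor N), U ≠ ⊥ ∧ W ≠ ⊥ ∧ IsCompl U W ∧
      ∀ A ∈ evenSpin N, (∀ u ∈ U, A u ∈ U) ∧ (∀ w ∈ W, A w ∈ W) := by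
  have hN' : N - 1 < N := by omega
  have hC : ∀ m : Bits N, (spinSystem N).flipLast (Finsupp.single m 1) =
      Finsupp.single (flipBit ⟨N - 1, hN'⟩ m) 1 := ladder_add_ladder_single ⟨N - 1, hN'⟩
  let m : Bits N := fun _ => false
  -- The flip sends one basis vector to a different one, so it is neither `1` nor `-1`.
  have hm := flipBit_ne ⟨N - 1, hN'⟩ m
  obtain ⟨U, W, hU, hW, hUW, h⟩ := exists_isCompl_invariant (C := (spinSystem N).flipLast)
    (fun v => LinearMap.congr_fun ((spinSystem N).flipLast_mul_self hN) v)
    ⟨Finsupp.single m 1, fun h => by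
      have := DFunLike.congr_fun ((hC m).symm.trans h) m
      simp [hm] at this⟩
    ⟨Finsupp.single m 1, fun h => by
      have := DFunLike.congr_fun ((hC m).symm.trans h) m
      simp [hm] at this⟩
  refine ⟨U, W, hU, hW, hUW, fun A hA => h A fun v => ?_⟩
  rw [evenSpin_eq] at hA
  exact LinearMap.congr_fun ((spinSystem N).commute_flipLast_of_mem_evenSpin hN hA).eq v

end

end SpinArith

theorem mainTheorem2 (N : ℕ) (hN : 0 < N) :
    SpinArith.evenSpin N ≤ SpinArith.oddSpin N N ∧
    (∃ φ : LieAlgebra.Orthogonal.so (Fin (2 * N)) ℂ ≃ₗ⁅ℂ⁆ SpinArith.evenSpin N,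
      SpinArith.IsSpinRepresentation (N := N)
        ((SpinArith.evenSpin N).incl.comp φ.toLieHom)) ∧
    (∃ U W : Submodule ℂ (SpinArith.Spinor N), U ≠ ⊥ ∧ W ≠ ⊥ ∧ IsCompl U W ∧
      ∀ A ∈ SpinArith.evenSpin N, (∀ u ∈ U, A u ∈ U) ∧ (∀ w ∈ W, A w ∈ W)) ∧
    (∃ b : Module.Basis (SpinArith.OddIndex (N - 1)) ℂ (SpinArith.oddSpin N (N - 1)),
      ∀ a, (b a : Module.End ℂ (SpinArith.Spinor N)) = SpinArith.oddElement N a) ∧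
    (∃ b : Module.Basis (SpinArith.EvenIndex N) ℂ (SpinArith.evenSpin N),
      ∀ a, (b a : Module.End ℂ (SpinArith.Spinor N)) = SpinArith.evenElement N a) := by
  refine ⟨?_, SpinArith.exists_lieEquiv_isSpinRepresentation hN,
    SpinArith.exists_decomposition hN, ?_, ?_⟩
  · rw [SpinArith.evenSpin_eq, SpinArith.oddSpin_eq le_rfl]
    exact (SpinArith.spinSystem N).evenSpin_le_oddSpin hN
  · simp only [SpinArith.oddElement_eq (Nat.sub_le N 1)]
    rw [SpinArith.oddSpin_eq (Nat.sub_le N 1)]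
    exact SpinArith.exists_basis_lieSubalgebra
      ((SpinArith.spinSystem N).linearIndependent_oddElement hN)
      ((SpinArith.spinSystem N).span_oddElement (Nat.sub_le N 1))
  · simp only [SpinArith.evenElement_eq]
    rw [SpinArith.evenSpin_eq]
    exact SpinArith.exists_basis_lieSubalgebra
      ((SpinArith.spinSystem N).linearIndependent_evenElement hN)
      ((SpinArith.spinSystem N).span_evenElement hN)
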